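/- For an entire function $f$ and $r>0$ write $M(r)=\max_{|z|=r}|f(z)|$ and $m(r)=\min_{|z|=r}|f(z)|$; write $C(r)=\{z\in\mathbb{C}:|z|=r\}$ and $\overline A(r_1,r_2)=\{z\in\mathbb{C}: r_1\le |z|\le r_2\}$. A continuum is a non-empty compact connected subset of $\mathbb{C}$. If $\Gamma$ is a continuum such that all zeros of $f$ lie in the unbounded component of $\mathbb{C}\setminus\Gamma$, and $z_0,z_0'\in\Gamma$ are distinct, put $\Delta\!\arg(f(\Gamma);z_0,z_0')=\operatorname{Im} g(z_0')-\operatorname{Im} g(z_0)$, where $g$ is any branch of $\log f$ in any simply connected domain $G$ that contains $\Gamma$ but no zeros of $f$ (the value does not depend on the choice of $G$ and $g$). **Theorem.** Let $f$ be a transcendental entire function of the form $$f(z)=c z^{p_0}\prod_{n=1}^{\infty}\left(1+\frac{z}{a_n}\right)^{p_n},$$ where $c\in\mathbb{R}\setminus\{0\}$, $p_n\in\{0,1,\ldots\}$ for $n\ge 0$, and the sequence $(a_n)$ is positive and strictly increasing. Suppose that there exist $\mu>1$ and $R_0>0$ such that for every $r\ge R_0$ there is $\rho\in(r,r^{\mu})$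 with $m(\rho)\ge M(r)$. Let $R_1>0$ be a constant such that $M(r^{\kappa})\ge M(r)^{\kappa}$ for all $r\ge R_1$ and $\kappa>1$ (such a constant exists for every transcendental entire function). Let $s,l,b>0$ satisfy $$s\ge\max\{1,R_0,R_1\},\quad l\ge\max\{\mu,1+b\},\quad M(s)\ge s^2,\quad s^{b/4}\ge\frac{48\sqrt2}{\pi},\quad \frac{b\,s^{b/4}}{l-b}\ge\frac{384\sqrt2}{\pi}.$$ If $\gamma$ is any continuum in $\{z:\operatorname{Im} z\ge 0\}$ that meets both $C(s)$ and $C(s^l)$, then at least one of the following holds: 1. $f(\gamma)$ meets both $C(M(s))$ and $C(M(s)^{l-b})$; 2. $f(\gamma)$ meets both $C(M(s)^{1/l})$ and $C(M(s))$; 3. there exist a continuum $\Gamma\subset\gamma\cap\overline A(s^{l-b},s^l)$ and distinct $z_0,z_0'\in\Gamma$ such that $f(\Gamma)\subset\overline A(M(s)^{1/l},M(s)^{l-b})$, all zeros of $f$ lie in the unbounded component of $\mathbb{C}\setminus\Gamma$, and $$\Delta\!\arg(f(\Gamma);z_0,z_0')\ \ge\ \frac{\pi^2 s^{b/4}\log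 M(s^{l-b})}{48\sqrt2\,\log s^{l-b}}\ \ge\ \frac{\pi^2 s^{b/4}\log M(s)}{48\sqrt2\,\log s}\ \ge\ 2\pi.$$ -/

import Mathlib

namespace EntireWinding

/-- The maximum modulus `M(r, f) = max_{|z| = r} |f z|`. -/
noncomputable def maxMod (f : ℂ → ℂ) (r : ℝ) : ℝ :=
  sSup ((fun z => ‖f z‖) '' Metric.sphere (0 : ℂ) r)

/-- The minimum modulus `m(r, f) = min_{|z| = r} |f z|`. -/
noncomputable def minMod (f : ℂ → ℂ) (r : ℝ) : ℝ :=
  sInf ((fun z => ‖f z‖) '' Metric.sphere (0 : ℂ) r)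

/-- A transcendental entire function: holomorphic on `ℂ` and not a polynomial. -/
def IsTranscendentalEntire (f : ℂ → ℂ) : Prop :=
  Differentiable ℂ f ∧ ¬ ∃ P : Polynomial ℂ, ∀ z : ℂ, f z = P.eval z

/-- `f z = c z ^ p₀ ∏ₙ (1 + z / aₙ) ^ pₙ` for all `z`, where `c` is real and non-zero, the `pₙ` are
natural numbers (possibly `0`), and `(aₙ)` is positive and strictly increasing. The infinite product
is the limit of its partial products; the sequences are indexed from `0` instead of `1`. -/
structure HasSymmetricProduct (f : ℂ → ℂ) (c : ℝ) (p₀ : ℕ) (p : ℕ → ℕ) (a : ℕ → ℝ) : Prop where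
  c_ne_zero : c ≠ 0
  a_pos : ∀ n, 0 < a n
  a_strictMono : StrictMono a
  tendsto_prod : ∀ z : ℂ,
    Filter.Tendsto
      (fun N : ℕ => (c : ℂ) * z ^ p₀ * ∏ n ∈ Finset.range N, (1 + z / (a n : ℂ)) ^ p n)
      Filter.atTop (nhds (f z))

/-- `R₁ > 0` is a constant for Hadamard convexity of `f`:
`M(r ^ κ) ≥ M(r) ^ κ` for all `r ≥ R₁` and `κ > 1`. -/
def IsHadamardConstant (f : ℂ → ℂ) (R₁ : ℝ) : Prop :=
  0 < R₁ ∧ ∀ r : ℝ, R₁ ≤ r → ∀ κ : ℝ, 1 < κ → maxMod f r ^ κ ≤ maxMod f (r ^ κ)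

/-- A plane continuum: a (non-empty) compact connected set. -/
def IsContinuum (γ : Set ℂ) : Prop :=
  IsCompact γ ∧ IsConnected γ

/-- The circle `C(r) = {z : |z| = r}`. -/
def circle (r : ℝ) : Set ℂ := {z | ‖z‖ = r}

/-- The closed annulus `{z : r₁ ≤ |z| ≤ r₂}`. -/
def closedAnnulus (r₁ r₂ : ℝ) : Set ℂ := {z | r₁ ≤ ‖z‖ ∧ ‖z‖ ≤ r₂}

/-- The set `S` meets the set `T`. -/
def Meets (S T : Set ℂ) : Prop := (S ∩ T).Nonempty

/-- `G` is a simply connected domain that contains `Γ` but no zeros of `f`, and `g` is a branch of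
`log f` in `G`. -/
structure IsLogBranchAround (f : ℂ → ℂ) (Γ G : Set ℂ) (g : ℂ → ℂ) : Prop where
  isOpen : IsOpen G
  simplyConnected : IsSimplyConnected G
  subset : Γ ⊆ G
  ne_zero : ∀ z ∈ G, f z ≠ 0
  differentiableOn : DifferentiableOn ℂ g G
  exp_eq : ∀ z ∈ G, Complex.exp (g z) = f z

/-- All zeros of `f` lie in the unbounded component of the complement of `Γ`. (For `z ∈ Γ` the set
`connectedComponentIn Γᶜ z` is empty, hence bounded.) -/
def ZerosInUnboundedComponent (f : ℂ → ℂ) (Γ : Set ℂ) : Prop :=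
  ∀ z : ℂ, f z = 0 → ¬ Bornology.IsBounded (connectedComponentIn Γᶜ z)

/-- The net change `Δarg(f(Γ); z₀, z₀')` of the argument of `f` along `Γ` from `z₀` to `z₀'` is
defined and equal to `δ`: `z₀, z₀'` are distinct points of `Γ`, all zeros of `f` lie in the unbounded
complementary component of `Γ`, and, for any choice of a simply connected domain `G` containing `Γ`
but no zeros of `f` and of a branch `g` of `log f` in `G` (and there is such a choice),
`δ = Im g(z₀') - Im g(z₀)`. -/
structure IsArgChange (f : ℂ → ℂ) (Γ : Set ℂ) (z₀ z₀' : ℂ) (δ : ℝ) : Prop where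
  left_mem : z₀ ∈ Γ
  right_mem : z₀' ∈ Γ
  ne : z₀ ≠ z₀'
  zeros : ZerosInUnboundedComponent f Γ
  exists_branch : ∃ (G : Set ℂ) (g : ℂ → ℂ), IsLogBranchAround f Γ G g
  eq_of_branch : ∀ (G : Set ℂ) (g : ℂ → ℂ), IsLogBranchAround f Γ G g →
    (g z₀').im - (g z₀).im = δ

end EntireWinding

/-!
Write `u = log |f|`. Each factor `1 + z / aₙ` decreases in modulus along the upper half of a circle
`|z| = r`, from the positive to the negative axis, so `u (r e^{iθ})` decreases in `θ ∈ [0, π]`, all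
zeros lie on the closed negative axis and `M(r) = |f r|`. If the first two alternatives fail, then
connectedness and the minimum modulus condition confine `|f|` on `γ` to the interval from
`M(s) ^ (1 / l)` to `M(s) ^ (l - b)`, and `M(s) ^ (l - b) ≤ M(R)` with `R = s ^ (l - b)`, by Hadamard
convexity. Put `T = log M(R)` and `X = s ^ (b / 4)`, so that `s ^ l = R X ^ 4`.

*Growth* (`growth_of_slit`). Since `γ` meets every circle `|z| = r` with `R ≤ r ≤ s ^ l`,
monotonicity gives `u (-r) ≤ T` there. Comparison with harmonic measure in a disc slit along its
negative radius, which is the three lines theorem after the substitution `z = ρ tan² (π p / 4)`,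
forces `D = log M(R X ^ 2) - T` to be at least a constant times `X T / log R`.

*Univalence* (`injOn_log_comp_exp`). In the coordinate `ξ = log z` the monotonicity of `u` says that
the derivative of `F = log f` has non-negative imaginary part on the strip `0 < Im ξ < π`, so `F` is
univalent there.

*Length and area* (`length_mul_log_le`). Let `Γ` be a subcontinuum of `γ` that crosses the annulus
`R X ^ 2 ≤ |z| ≤ R X ^ 4`. On `Γ` the function `F` takes values in the box of width `T` and height the
oscillation `δ` of the argument. A vertical segment of the strip starts on the positive axis, where
`Re F ≥ T + D`, and reaches this box within the right half-plane, since `u` decreases along it. So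
the images of these segments all cross the half annulus about the middle of the left-hand side of
the box with radii `σ = √(T ^ 2 + (δ / 2) ^ 2)` and `T + D`. The length-area inequality yields
`2 log X · log ((T + D) / σ) ≤ π ^ 2`, and if `δ` were less than asserted, then this would contradict
the growth estimate and the size conditions on `s` (`pi_sq_lt_mul_log`).

For the definition of `δ`, a branch of `log f` lives on a domain that is star-shaped with respect to
`i` and contains the closed upper half-plane except the zeros (`logDomain`); any other admissible
branch differs from it by a constant on `Γ`, because `Γ` is connected.
-/

namespace EntireWinding

open Complex Set Filter Topology ComplexConjugate MeasureTheory
open scoped ENNReal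

/-! ### The modulus of a product with negative zeros -/

/-- On a half circle, `‖1 + x e^{iθ}‖` decreases as the point moves from the positive to the
negative real axis. -/
lemma antitoneOn_norm_one_add_mul_exp {x : ℝ} (hx : 0 ≤ x) :
    AntitoneOn (fun θ : ℝ => ‖1 + (x : ℂ) * exp (θ * I)‖) (Icc 0 Real.pi) := by
  have key : ∀ θ : ℝ, ‖1 + (x : ℂ) * exp (θ * I)‖ ^ 2 = 1 + 2 * x * Real.cos θ + x ^ 2 := by
    intro θ
    rw [← normSq_eq_norm_sq, exp_mul_I, ← ofReal_cos, ← ofReal_sin, normSq_apply]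
    simp only [add_re, one_re, mul_re, ofReal_re, ofReal_im, I_re, I_im, add_im, one_im, mul_im]
    linear_combination x ^ 2 * Real.sin_sq_add_cos_sq θ
  intro θ₁ h₁ θ₂ h₂ h
  have hcos := Real.strictAntiOn_cos.antitoneOn h₁ h₂ h
  refine abs_le_of_sq_le_sq' ?_ (norm_nonneg _) |>.2
  rw [key, key]
  nlinarith

namespace HasSymmetricProduct

variable {f : ℂ → ℂ} {c : ℝ} {p₀ : ℕ} {p : ℕ → ℕ} {a : ℕ → ℝ}

lemma antitoneOn_norm (h : HasSymmetricProduct f c p₀ p a) {r : ℝ} (hr : 0 ≤ r) :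
    AntitoneOn (fun θ : ℝ => ‖f (r * exp (θ * I))‖) (Icc 0 Real.pi) := by
  intro θ₁ h₁ θ₂ h₂ h₁₂
  refine le_of_tendsto_of_tendsto' (h.tendsto_prod _).norm (h.tendsto_prod _).norm fun N => ?_
  simp only [norm_mul, norm_pow, norm_prod, norm_exp_ofReal_mul_I]
  gcongr with n
  have ha := h.a_pos n
  have := antitoneOn_norm_one_add_mul_exp (x := r / a n) (by positivity) h₁ h₂ h₁₂
  simpa [div_mul_eq_mul_div] using this

lemma norm_conj (h : HasSymmetricProduct f c p₀ p a) (z : ℂ) : ‖f (conj z)‖ = ‖f z‖ := by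
  refine tendsto_nhds_unique (h.tendsto_prod _).norm ?_
  convert (h.tendsto_prod z).norm using 2 with N
  rw [← Complex.norm_conj (_ * _)]
  simp

lemma monotoneOn_norm (h : HasSymmetricProduct f c p₀ p a) :
    MonotoneOn (fun x : ℝ => ‖f x‖) (Ici 0) := by
  intro x hx y hy hxy
  refine le_of_tendsto_of_tendsto' (h.tendsto_prod _).norm (h.tendsto_prod _).norm fun N => ?_
  simp only [norm_mul, norm_pow, norm_prod]
  have hx : 0 ≤ x := hx
  have hy : 0 ≤ y := hy
  have e : ∀ u : ℝ, 0 ≤ u → ∀ n, ‖1 + (u : ℂ) / a n‖ = 1 + u / a n := by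
    intro u hu n
    have := h.a_pos n
    rw [← ofReal_div, ← ofReal_one, ← ofReal_add, Complex.norm_of_nonneg (by positivity)]
  simp only [e x hx, e y hy, Complex.norm_of_nonneg hx, Complex.norm_of_nonneg hy]
  have h0 : ∀ n, 0 ≤ 1 + x / a n := fun n => by have := h.a_pos n; positivity
  gcongr with n
  · exact Finset.prod_nonneg fun n _ => pow_nonneg (h0 n) _
  · exact fun n _ => pow_nonneg (h0 n) _
  · exact h0 _
  · exact (h.a_pos _).le

lemma ne_zero_of_pos (h : HasSymmetricProduct f c p₀ p a) {x : ℝ} (hx : 0 < x) :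
    f x ≠ 0 := by
  have : |c| * x ^ p₀ ≤ ‖f x‖ := by
    refine ge_of_tendsto' (h.tendsto_prod x).norm fun N => ?_
    simp only [norm_mul, norm_pow, norm_prod, norm_real, Real.norm_eq_abs, abs_of_pos hx]
    refine le_mul_of_one_le_right (by positivity) ?_
    refine Finset.one_le_prod fun n _ => one_le_pow₀ ?_
    have := h.a_pos n
    rw [← ofReal_div, ← ofReal_one, ← ofReal_add, Complex.norm_of_nonneg (by positivity)]
    have : 0 ≤ x / a n := by positivity
    linarith
  have h2 : 0 < |c| * x ^ p₀ := mul_pos (abs_pos.2 h.c_ne_zero) (by positivity)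
  exact norm_pos_iff.1 (h2.trans_le this)

/-- A zero off the closed negative axis would, by monotonicity of the modulus on half circles,
propagate to a whole arc. -/
lemma eq_zero_imp (h : HasSymmetricProduct f c p₀ p a) (hd : Differentiable ℂ f) {z : ℂ}
    (hz : f z = 0) : z.im = 0 ∧ z.re ≤ 0 := by
  have main : ∀ z : ℂ, 0 ≤ z.im → f z = 0 → z.im = 0 ∧ z.re ≤ 0 := by
    intro z hzi hz
    rcases eq_or_ne z 0 with rfl | hz0
    · simp
    have harg : arg z ∈ Icc 0 Real.pi := ⟨arg_nonneg_iff.2 hzi, arg_le_pi z⟩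
    rcases eq_or_lt_of_le harg.2 with hpi | hlt
    · have := arg_eq_pi_iff.1 hpi
      exact ⟨this.2, this.1.le⟩
    exfalso
    have hpolar : (‖z‖ : ℂ) * exp (arg z * I) = z := norm_mul_exp_arg_mul_I z
    have hzero : ∀ θ ∈ Ioc (arg z) Real.pi, f (‖z‖ * exp (θ * I)) = 0 := by
      intro θ hθ
      have := h.antitoneOn_norm (norm_nonneg z) harg ⟨harg.1.trans hθ.1.le, hθ.2⟩ hθ.1.le
      simp only [hpolar, hz, norm_zero] at this
      exact norm_le_zero_iff.1 this
    have hcont : Tendsto (fun θ : ℝ => (‖z‖ : ℂ) * exp (θ * I)) (𝓝[>] (arg z)) (𝓝[≠] z) := by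
      refine tendsto_nhdsWithin_iff.2 ⟨?_, ?_⟩
      · have : ContinuousAt (fun θ : ℝ => (‖z‖ : ℂ) * exp (θ * I)) (arg z) := by fun_prop
        have h2 := this.tendsto
        rw [hpolar] at h2
        exact h2.mono_left nhdsWithin_le_nhds
      · filter_upwards [Ioc_mem_nhdsGT hlt] with θ hθ heq
        have h1 : arg ((‖z‖ : ℂ) * exp (θ * I)) = θ := by
          rw [exp_mul_I]
          exact arg_mul_cos_add_sin_mul_I (norm_pos_iff.2 hz0)
            ⟨by linarith [hθ.1, harg.1, Real.pi_pos], hθ.2⟩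
        rw [heq] at h1
        exact hθ.1.ne h1
    have hfreq : ∃ᶠ w in 𝓝[≠] z, f w = 0 :=
      hcont.frequently (Eventually.frequently (by
        filter_upwards [Ioc_mem_nhdsGT hlt] with θ hθ using hzero θ hθ))
    have han := hd.differentiableOn.analyticOnNhd isOpen_univ
    have := han.eqOn_zero_of_preconnected_of_frequently_eq_zero
      isPreconnected_univ (mem_univ z) hfreq (mem_univ ((1 : ℝ) : ℂ))
    exact h.ne_zero_of_pos one_pos this
  rcases le_total 0 z.im with hi | hi
  · exact main z hi hz
  · have := main (conj z) (by simpa using hi) (by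
      rw [← norm_eq_zero, h.norm_conj, hz, norm_zero])
    simpa using this

lemma norm_le_norm_norm (h : HasSymmetricProduct f c p₀ p a) (z : ℂ) :
    ‖f z‖ ≤ ‖f (‖z‖ : ℝ)‖ := by
  have main : ∀ z : ℂ, 0 ≤ z.im → ‖f z‖ ≤ ‖f (‖z‖ : ℝ)‖ := by
    intro z hi
    have := h.antitoneOn_norm (norm_nonneg z) ⟨le_rfl, Real.pi_pos.le⟩
      ⟨arg_nonneg_iff.2 hi, arg_le_pi z⟩ (arg_nonneg_iff.2 hi)
    simpa [norm_mul_exp_arg_mul_I] using this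
  rcases le_total 0 z.im with hi | hi
  · exact main z hi
  · simpa [h.norm_conj] using main (conj z) (by simpa using hi)

lemma norm_neg_norm_le (h : HasSymmetricProduct f c p₀ p a) {z : ℂ} (hi : 0 ≤ z.im) :
    ‖f (-‖z‖ : ℝ)‖ ≤ ‖f z‖ := by
  have := h.antitoneOn_norm (norm_nonneg z)
    ⟨arg_nonneg_iff.2 hi, arg_le_pi z⟩ ⟨Real.pi_pos.le, le_rfl⟩ (arg_le_pi z)
  simpa [norm_mul_exp_arg_mul_I] using this

lemma maxMod_eq (h : HasSymmetricProduct f c p₀ p a) {r : ℝ} (hr : 0 ≤ r) :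
    maxMod f r = ‖f r‖ := by
  refine IsGreatest.csSup_eq ⟨⟨(r : ℂ), by simp [hr], rfl⟩, ?_⟩
  rintro _ ⟨z, hz, rfl⟩
  have hz : ‖z‖ = r := by simpa using hz
  simpa [hz] using h.norm_le_norm_norm z

lemma maxMod_pos (h : HasSymmetricProduct f c p₀ p a) {r : ℝ} (hr : 0 < r) :
    0 < maxMod f r := by
  rw [h.maxMod_eq hr.le]
  exact norm_pos_iff.2 (h.ne_zero_of_pos hr)

lemma norm_le_maxMod (h : HasSymmetricProduct f c p₀ p a) {z : ℂ} {r : ℝ} (hz : ‖z‖ ≤ r) :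
    ‖f z‖ ≤ maxMod f r := by
  rw [h.maxMod_eq ((norm_nonneg z).trans hz)]
  exact (h.norm_le_norm_norm z).trans
    (h.monotoneOn_norm (norm_nonneg z) ((norm_nonneg z).trans hz) hz)

end HasSymmetricProduct

lemma minMod_le_norm (f : ℂ → ℂ) (z : ℂ) : minMod f ‖z‖ ≤ ‖f z‖ :=
  csInf_le ⟨0, by rintro _ ⟨w, -, rfl⟩; exact norm_nonneg _⟩ ⟨z, by simp, rfl⟩

/-! ### A branch of the logarithm above the zeros -/

/-- A branch of `log f` on an open set is holomorphic as soon as it is continuous. -/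
lemma differentiableOn_of_exp_eq {f g : ℂ → ℂ} {G : Set ℂ} (hG : IsOpen G)
    (hf : Differentiable ℂ f) (hg : ContinuousOn g G) (h : ∀ z ∈ G, exp (g z) = f z) :
    DifferentiableOn ℂ g G := by
  intro z hz
  have hfz : f z ≠ 0 := by rw [← h z hz]; exact exp_ne_zero _
  have hgz : ContinuousAt g z := hg.continuousAt (hG.mem_nhds hz)
  have h1 : ∀ᶠ w in 𝓝 z, |(g w - g z).im| < Real.pi := by
    have : ContinuousAt (fun w => |(g w - g z).im|) z :=
      (continuous_im.continuousAt.comp (hgz.sub continuousAt_const)).abs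
    exact this.eventually_lt continuousAt_const (by simp [Real.pi_pos])
  have h2 : g =ᶠ[𝓝 z] fun w => g z + log (f w / f z) := by
    filter_upwards [h1, hG.mem_nhds hz] with w hw hwG
    rw [← h w hwG, ← h z hz, ← exp_sub, log_exp (neg_lt_of_abs_lt hw) (lt_of_abs_lt hw).le]
    ring
  refine DifferentiableAt.differentiableWithinAt ?_
  refine DifferentiableAt.congr_of_eventuallyEq ?_ h2
  refine (((hf z).div_const _).clog ?_).const_add _
  rw [div_self hfz]
  exact one_mem_slitPlane

/-- The plane cut along the rays that start at the real zeros of `f` and point away from `i`; it is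
star-shaped with respect to `i` and contains the closed upper half-plane apart from the zeros. -/
def logDomain (f : ℂ → ℂ) : Set ℂ := {z | z.im ≤ 0 → f ((z.re / (1 - z.im) : ℝ) : ℂ) ≠ 0}

lemma isOpen_logDomain {f : ℂ → ℂ} (hf : Continuous f) : IsOpen (logDomain f) := by
  have hcl : IsClosed {z : ℂ | z.im ≤ 0} := isClosed_le continuous_im continuous_const
  have hcont : ContinuousOn (fun z : ℂ => f ((z.re / (1 - z.im) : ℝ) : ℂ)) {z : ℂ | z.im ≤ 0} := by
    refine hf.comp_continuousOn (continuous_ofReal.comp_continuousOn ?_)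
    refine continuous_re.continuousOn.div (by fun_prop) fun z hz => ?_
    have : z.im ≤ 0 := hz
    linarith
  have := hcont.preimage_isClosed_of_isClosed hcl (isClosed_singleton (x := (0 : ℂ)))
  convert this.isOpen_compl using 1
  ext z
  simp [logDomain]

lemma starConvex_logDomain (f : ℂ → ℂ) : StarConvex ℝ I (logDomain f) := by
  intro z hz α τ hα hτ hατ him
  have e1 : (α • I + τ • z).im = α + τ * z.im := by simp
  have e2 : (α • I + τ • z).re = τ * z.re := by simp
  rw [e1] at him
  have hτ0 : τ ≠ 0 := by
    rintro rfl
    linarith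
  have hτ' : 0 < τ := lt_of_le_of_ne hτ hτ0.symm
  have hz0 : z.im ≤ 0 := by
    by_contra! hcon
    nlinarith [mul_pos hτ' hcon]
  have : (1 - (α + τ * z.im)) = τ * (1 - z.im) := by linear_combination -hατ
  rw [e1, e2, this, mul_div_mul_left _ _ hτ0]
  exact hz hz0

lemma isSimplyConnected_logDomain (f : ℂ → ℂ) : IsSimplyConnected (logDomain f) := by
  have : ContractibleSpace (logDomain f) :=
    (starConvex_logDomain f).contractibleSpace ⟨I, fun h => by norm_num at h⟩
  exact inferInstanceAs (SimplyConnectedSpace (logDomain f))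

lemma mem_logDomain {f : ℂ → ℂ} {z : ℂ} (him : 0 ≤ z.im) (hz : f z ≠ 0) : z ∈ logDomain f := by
  intro h
  have h0 : z.im = 0 := le_antisymm h him
  rwa [h0, sub_zero, div_one, show ((z.re : ℝ) : ℂ) = z from ext (by simp) (by simp [h0])]

lemma exists_isLogBranchAround {f : ℂ → ℂ} (hf : Differentiable ℂ f)
    (hreal : ∀ z, f z = 0 → z.im = 0) :
    ∃ g : ℂ → ℂ, IsLogBranchAround f (logDomain f) (logDomain f) g := by
  have hne : ∀ z ∈ logDomain f, f z ≠ 0 := by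
    intro z hz h0
    have him := hreal z h0
    refine hz him.le ?_
    rwa [him, sub_zero, div_one, show ((z.re : ℝ) : ℂ) = z from ext (by simp) (by simp [him])]
  obtain ⟨g, hg, he⟩ := exists_continuousOn_eqOn_exp_comp (isSimplyConnected_logDomain f)
    (isOpen_logDomain hf.continuous) (g := f) hf.continuous.continuousOn
    (by rintro ⟨z, hz, h0⟩; exact hne z hz h0)
  exact ⟨g, isOpen_logDomain hf.continuous, isSimplyConnected_logDomain f, subset_rfl, hne,
    differentiableOn_of_exp_eq (isOpen_logDomain hf.continuous) hf hg he, he⟩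

/-- Two branches of `log f` differ by a constant on a connected set. -/
lemma im_sub_im_eq_of_exp_eq {g₁ g₂ : ℂ → ℂ} {Γ : Set ℂ} (hΓ : IsPreconnected Γ)
    (h₁ : ContinuousOn g₁ Γ) (h₂ : ContinuousOn g₂ Γ) (h : ∀ z ∈ Γ, exp (g₁ z) = exp (g₂ z))
    {z w : ℂ} (hz : z ∈ Γ) (hw : w ∈ Γ) :
    (g₁ w).im - (g₁ z).im = (g₂ w).im - (g₂ z).im := by
  have hpi := Real.two_pi_pos
  have hc : ContinuousOn (fun z => ((g₁ z).im - (g₂ z).im) / (2 * Real.pi)) Γ :=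
    ((continuous_im.comp_continuousOn h₁).sub (continuous_im.comp_continuousOn h₂)).div_const _
  have hm : MapsTo (fun z => ((g₁ z).im - (g₂ z).im) / (2 * Real.pi)) Γ
      (range ((↑) : ℤ → ℝ)) := by
    intro z hz
    obtain ⟨n, hn⟩ := exp_eq_exp_iff_exists_int.1 (h z hz)
    refine ⟨n, ?_⟩
    have : (g₁ z).im = (g₂ z).im + n * (2 * Real.pi) := by
      rw [hn]; simp
    field_simp
    linarith
  have hdisc : DiscreteTopology (range ((↑) : ℤ → ℝ)) :=
    (Int.isClosedEmbedding_coe_real.isEmbedding.toHomeomorph.discreteTopology_iff).1 inferInstance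
  have := hΓ.constant_of_mapsTo (T := range ((↑) : ℤ → ℝ)) ⟨hdisc⟩ hc hm hz hw
  field_simp at this
  linarith

/-- A zero on the real axis can be joined to infinity through the lower half-plane. -/
lemma zerosInUnboundedComponent {f : ℂ → ℂ} {Γ : Set ℂ} (hΓ : Γ ⊆ {z : ℂ | 0 ≤ z.im})
    (hreal : ∀ z, f z = 0 → z.im = 0) (hne : ∀ z ∈ Γ, f z ≠ 0) :
    ZerosInUnboundedComponent f Γ := by
  intro z hz hb
  have him := hreal z hz
  let ray : Set ℂ := (fun t : ℝ => z - t * I) '' Ici 0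
  have hconn : IsPreconnected ray := isPreconnected_Ici.image _ (by fun_prop)
  have hsub : ray ⊆ Γᶜ := by
    rintro _ ⟨t, ht, rfl⟩ hmem
    have ht : 0 ≤ t := ht
    have h1 : 0 ≤ (z - t * I).im := hΓ hmem
    have h2 : t = 0 := by simp [him] at h1; linarith
    subst h2
    exact hne _ hmem (by simpa using hz)
  have hray := hconn.subset_connectedComponentIn (x := z) ⟨0, self_mem_Ici, by simp⟩ hsub
  obtain ⟨C, hC⟩ := (hb.subset hray).exists_norm_le
  have h1 := hC (z - ((|C| + 1 : ℝ) : ℂ) * I) ⟨|C| + 1, by simp; positivity, rfl⟩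
  have h2 := (abs_im_le_norm _).trans h1
  simp only [sub_im, him, mul_im, ofReal_re, I_im, ofReal_im, I_re] at h2
  have h3 : |0 - ((|C| + 1) * 1 + 0 * 0)| = |C| + 1 := by
    rw [abs_sub_comm, abs_of_nonneg] <;> [ring; (ring_nf; positivity)]
  rw [h3] at h2
  linarith [le_abs_self C]

lemma isArgChange_of_branch {f g : ℂ → ℂ} {Γ : Set ℂ}
    (hreal : ∀ z, f z = 0 → z.im = 0) (hg : IsLogBranchAround f (logDomain f) (logDomain f) g)
    (hΓ : IsPreconnected Γ) (hup : Γ ⊆ {z : ℂ | 0 ≤ z.im}) (hne : ∀ z ∈ Γ, f z ≠ 0)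
    {z₀ z₀' : ℂ} (h₀ : z₀ ∈ Γ) (h₀' : z₀' ∈ Γ) (hz : z₀ ≠ z₀') :
    IsArgChange f Γ z₀ z₀' ((g z₀').im - (g z₀).im) := by
  have hsub : Γ ⊆ logDomain f := fun z hz => mem_logDomain (hup hz) (hne z hz)
  refine ⟨h₀, h₀', hz, zerosInUnboundedComponent hup hreal hne,
    ⟨logDomain f, g, { hg with subset := hsub }⟩, fun G g' hg' => ?_⟩
  exact im_sub_im_eq_of_exp_eq hΓ (hg'.differentiableOn.continuousOn.mono hg'.subset)
    (hg.differentiableOn.continuousOn.mono hsub)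
    (fun z hz => by rw [hg'.exp_eq z (hg'.subset hz), hg.exp_eq z (hsub hz)]) h₀ h₀'

/-! ### A continuum crossing an annulus -/

/-- In a compact Hausdorff space, two closed sets that no component meets both of are separated by a
clopen set. -/
lemma exists_isClopen_separating {X : Type*} [TopologicalSpace X] [T2Space X] [CompactSpace X]
    {A B : Set X} (hA : IsClosed A) (hB : IsClosed B)
    (h : ∀ x ∈ A, Disjoint (connectedComponent x) B) :
    ∃ U : Set X, IsClopen U ∧ A ⊆ U ∧ Disjoint U B := by
  have hx : ∀ x ∈ A, ∃ U : Set X, IsClopen U ∧ x ∈ U ∧ Disjoint U B := by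
    intro x hxA
    have hd := h x hxA
    rw [connectedComponent_eq_iInter_isClopen, disjoint_iff_inter_eq_empty, inter_comm] at hd
    obtain ⟨t, ht⟩ := hB.isCompact.elim_finite_subfamily_closed _ (fun i => i.2.1.isClosed) hd
    refine ⟨⋂ i ∈ t, (i : Set X), isClopen_biInter_finset fun i _ => i.2.1,
      mem_iInter₂.2 fun i _ => i.2.2, ?_⟩
    rwa [disjoint_iff_inter_eq_empty, inter_comm]
  choose! U hU using hx
  obtain ⟨t, htA, ht⟩ := hA.isCompact.elim_nhds_subcover U
    fun x hx => (hU x hx).1.isOpen.mem_nhds (hU x hx).2.1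
  refine ⟨⋃ x ∈ t, U x, isClopen_biUnion_finset fun x hx => (hU x (htA x hx)).1, ht, ?_⟩
  simp only [disjoint_iUnion_left]
  exact fun x hx => (hU x (htA x hx)).2.2

/-- A continuum that meets two concentric circles contains a continuum that lies in the closed
annulus between them and meets both. -/
lemma exists_continuum_crossing {γ : Set ℂ} (hγ : IsContinuum γ) {r₁ r₂ : ℝ} (hr : r₁ < r₂)
    (h₁ : ∃ z ∈ γ, ‖z‖ ≤ r₁) (h₂ : ∃ z ∈ γ, r₂ ≤ ‖z‖) :
    ∃ Γ ⊆ γ ∩ closedAnnulus r₁ r₂, IsContinuum Γ ∧ (∃ z ∈ Γ, ‖z‖ = r₁) ∧ ∃ z ∈ Γ, ‖z‖ = r₂ := by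
  set K : Set ℂ := γ ∩ closedAnnulus r₁ r₂ with hK
  have hKc : IsCompact K := hγ.1.inter_right
    ((isClosed_le continuous_const continuous_norm).inter
      (isClosed_le continuous_norm continuous_const))
  have : CompactSpace K := isCompact_iff_compactSpace.1 hKc
  set A : Set K := {z | ‖(z : ℂ)‖ = r₁} with hA
  set B : Set K := {z | ‖(z : ℂ)‖ = r₂} with hB
  have hAc : IsClosed A := isClosed_eq (by fun_prop) continuous_const
  have hBc : IsClosed B := isClosed_eq (by fun_prop) continuous_const
  by_cases hcross : ∃ x ∈ A, ¬ Disjoint (connectedComponent x) B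
  · obtain ⟨x, hx, hd⟩ := hcross
    obtain ⟨y, hy, hyB⟩ := not_disjoint_iff.1 hd
    refine ⟨Subtype.val '' connectedComponent x, ?_, ⟨?_, ?_⟩, ⟨x, ⟨x, mem_connectedComponent, rfl⟩, hx⟩,
      ⟨y, ⟨y, hy, rfl⟩, hyB⟩⟩
    · rintro _ ⟨z, -, rfl⟩
      exact z.2
    · exact isClosed_connectedComponent.isCompact.image continuous_subtype_val
    · exact isConnected_connectedComponent.image _ continuous_subtype_val.continuousOn
  · exfalso
    push Not at hcross
    obtain ⟨U, hU, hAU, hUB⟩ := exists_isClopen_separating hAc hBc hcross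
    have c1 : IsClosed (Subtype.val '' U : Set ℂ) :=
      (hU.isClosed.isCompact.image continuous_subtype_val).isClosed
    have c2 : IsClosed (Subtype.val '' Uᶜ : Set ℂ) :=
      (hU.compl.isClosed.isCompact.image continuous_subtype_val).isClosed
    set V₁ : Set ℂ := {z | ‖z‖ ≤ r₁} ∩ γ ∪ Subtype.val '' U
    set V₂ : Set ℂ := {z | r₂ ≤ ‖z‖} ∩ γ ∪ Subtype.val '' Uᶜ
    have hV₁ : IsClosed V₁ :=
      ((isClosed_le continuous_norm continuous_const).inter hγ.1.isClosed).union c1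
    have hV₂ : IsClosed V₂ :=
      ((isClosed_le continuous_const continuous_norm).inter hγ.1.isClosed).union c2
    have hcover : γ ⊆ V₁ ∪ V₂ := by
      intro z hz
      by_cases hz1 : ‖z‖ ≤ r₁
      · exact Or.inl (Or.inl ⟨hz1, hz⟩)
      by_cases hz2 : r₂ ≤ ‖z‖
      · exact Or.inr (Or.inl ⟨hz2, hz⟩)
      push Not at hz1 hz2
      have hzK : z ∈ K := ⟨hz, hz1.le, hz2.le⟩
      by_cases hzU : (⟨z, hzK⟩ : K) ∈ U
      · exact Or.inl (Or.inr ⟨_, hzU, rfl⟩)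
      · exact Or.inr (Or.inr ⟨_, hzU, rfl⟩)
    obtain ⟨z₁, hz₁, hz₁'⟩ := h₁
    obtain ⟨z₂, hz₂, hz₂'⟩ := h₂
    obtain ⟨z, hz, hzV₁, hzV₂⟩ := isPreconnected_closed_iff.1 hγ.2.isPreconnected V₁ V₂ hV₁ hV₂
      hcover ⟨z₁, hz₁, Or.inl ⟨hz₁', hz₁⟩⟩ ⟨z₂, hz₂, Or.inl ⟨hz₂', hz₂⟩⟩
    rcases hzV₁ with ⟨ha, -⟩ | ⟨w, hwU, rfl⟩
    · rcases hzV₂ with ⟨hb, -⟩ | ⟨w, hwU, rfl⟩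
      · exact absurd (hb.trans ha) (not_le.2 hr)
      · exact hwU (hAU (le_antisymm ha w.2.2.1))
    · rcases hzV₂ with ⟨hb, -⟩ | ⟨w', hwU', hw'⟩
      · exact disjoint_left.1 hUB hwU (le_antisymm w.2.2.2 hb)
      · exact hwU' ((Subtype.val_injective hw') ▸ hwU)

/-! ### Growth on the positive axis -/

/-- The map `p ↦ ρ tan² (π p / 4)`, written with `cos (π p / 2)`, carries the strip
`0 ≤ Re p ≤ 1` to the disc of radius `ρ` slit along its negative radius. -/
lemma norm_le_interp_of_slit {f : ℂ → ℂ} (hf : Differentiable ℂ f) {ρ A B : ℝ} (hρ : 0 ≤ ρ)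
    (hA : ∀ x ∈ Icc 0 ρ, ‖f ((-x : ℝ) : ℂ)‖ ≤ A) (hB : ∀ z, ‖z‖ ≤ ρ → ‖f z‖ ≤ B)
    {x : ℝ} (hx : x ∈ Icc (0 : ℝ) 1) :
    ‖f ((ρ * Real.tan (Real.pi * x / 4) ^ 2 : ℝ) : ℂ)‖ ≤ A ^ (1 - x) * B ^ x := by
  have hpi := Real.pi_pos
  let C : ℂ → ℂ := fun p => cos (Real.pi * p / 2)
  let q : ℂ → ℂ := fun p => ρ * ((1 - C p) / (1 + C p))
  have hCre : ∀ p : ℂ, (C p).re = Real.cos (Real.pi * p.re / 2) * Real.cosh (Real.pi * p.im / 2) := by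
    intro p
    have e : (Real.pi * p / 2 : ℂ) =
        ((Real.pi * p.re / 2 : ℝ) : ℂ) + ((Real.pi * p.im / 2 : ℝ) : ℂ) * I := by
      push_cast
      linear_combination (Real.pi / 2 : ℂ) * (re_add_im p).symm
    simp only [C]
    rw [e, cos_add_mul_I, ← ofReal_cos, ← ofReal_cosh, ← ofReal_sin, ← ofReal_sinh]
    simp only [sub_re, mul_re, ofReal_re, ofReal_im, I_re, I_im, mul_im]
    ring
  have hCnonneg : ∀ p : ℂ, p.re ∈ Icc (0 : ℝ) 1 → 0 ≤ (C p).re := by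
    intro p hp
    rw [hCre]
    refine mul_nonneg (Real.cos_nonneg_of_neg_pi_div_two_le_of_le ?_ ?_) (Real.cosh_pos _).le <;>
      nlinarith [hp.1, hp.2]
  have hne : ∀ p : ℂ, p.re ∈ Icc (0 : ℝ) 1 → 1 + C p ≠ 0 := by
    intro p hp h0
    have h1 := congrArg re h0
    simp only [add_re, one_re, zero_re] at h1
    linarith [hCnonneg p hp]
  have hqnorm : ∀ p : ℂ, p.re ∈ Icc (0 : ℝ) 1 → ‖q p‖ ≤ ρ := by
    intro p hp
    have h2 : ‖1 - C p‖ ≤ ‖1 + C p‖ := by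
      refine abs_le_of_sq_le_sq' ?_ (norm_nonneg _) |>.2
      rw [← normSq_eq_norm_sq, ← normSq_eq_norm_sq, normSq_apply, normSq_apply]
      simp only [sub_re, one_re, sub_im, one_im, add_re, add_im]
      nlinarith [hCnonneg p hp]
    simp only [q, norm_mul, norm_div, norm_real, Real.norm_eq_abs, abs_of_nonneg hρ]
    exact mul_le_of_le_one_right hρ (div_le_one_of_le₀ h2 (norm_nonneg _))
  have hqd : ∀ p : ℂ, p.re ∈ Icc (0 : ℝ) 1 → DifferentiableAt ℂ (fun p => f (q p)) p := by
    intro p hp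
    have hC : Differentiable ℂ C := by fun_prop
    have : DifferentiableAt ℂ q p :=
      (((hC p).const_sub 1).div ((hC p).const_add 1) (hne p hp)).const_mul _
    exact (hf _).comp p this
  have hmain := HadamardThreeLines.norm_le_interp_of_mem_verticalClosedStrip₀₁' (fun p => f (q p))
    (z := (x : ℂ)) (a := A) (b := B) (by simpa [HadamardThreeLines.verticalClosedStrip] using hx)
    ?_ ?_ ?_ ?_
  · rw [ofReal_re] at hmain
    convert hmain using 1
    · congr 2
      have e1 : C x = ((2 * Real.cos (Real.pi * x / 4) ^ 2 - 1 : ℝ) : ℂ) := by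
        rw [← Real.cos_two_mul, ofReal_cos]
        simp only [C]
        push_cast
        ring_nf
      have hc0 : Real.cos (Real.pi * x / 4) ≠ 0 := by
        refine (Real.cos_pos_of_mem_Ioo ⟨?_, ?_⟩).ne' <;> nlinarith [hx.1, hx.2]
      simp only [q, e1]
      norm_cast
      have : 1 - (2 * Real.cos (Real.pi * x / 4) ^ 2 - 1) = 2 * Real.sin (Real.pi * x / 4) ^ 2 := by
        linear_combination -2 * Real.sin_sq_add_cos_sq (Real.pi * x / 4)
      rw [this, Real.tan_eq_sin_div_cos]
      field_simp
      ring
  · refine DifferentiableOn.diffContOnCl fun p hp => (hqd p ?_).differentiableWithinAt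
    rw [HadamardThreeLines.verticalStrip, closure_preimage_re, closure_Ioo zero_ne_one] at hp
    exact hp
  · refine ⟨B, ?_⟩
    rintro _ ⟨p, hp, rfl⟩
    exact hB _ (hqnorm p hp)
  · intro p hp
    have hp0 : p.re = 0 := hp
    have e : C p = ((Real.cosh (Real.pi * p.im / 2) : ℝ) : ℂ) := by
      have : p = (p.im : ℂ) * I := Complex.ext (by simp [hp0]) (by simp)
      simp only [C]
      conv_lhs => rw [this]
      rw [ofReal_cosh, ← cos_mul_I]
      push_cast
      ring_nf
    set h := Real.cosh (Real.pi * p.im / 2)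
    have hh : 1 ≤ h := Real.one_le_cosh _
    have : q p = ((-(ρ * ((h - 1) / (1 + h))) : ℝ) : ℂ) := by
      simp only [q, e]
      norm_cast
      ring_nf
    show ‖f (q p)‖ ≤ A
    rw [this]
    refine hA _ ⟨mul_nonneg hρ (div_nonneg (by linarith) (by linarith)),
      mul_le_of_le_one_right hρ ((div_le_one₀ (by linarith)).2 (by linarith))⟩
  · intro p hp
    have hp1 : p.re = 1 := hp
    exact hB _ (hqnorm p (by rw [hp1]; simp))

/-- Comparison with the harmonic measure of the circle in a slit disc: if `f` is bounded by `A` on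
the negative radius and by `B` in the disc, then `log |f|` on the positive radius exceeds `log A` by
at most a multiple of the square root of the distance to the centre. -/
lemma log_norm_le_of_slit {f : ℂ → ℂ} (hf : Differentiable ℂ f) {ρ A B : ℝ} (hρ : 0 ≤ ρ)
    (hA₀ : 0 < A) (hAB : A ≤ B)
    (hA : ∀ x ∈ Icc 0 ρ, ‖f ((-x : ℝ) : ℂ)‖ ≤ A) (hB : ∀ z, ‖z‖ ≤ ρ → ‖f z‖ ≤ B)
    {t : ℝ} (ht : t ∈ Icc (0 : ℝ) 1) (hft : f ((ρ * t ^ 2 : ℝ) : ℂ) ≠ 0) :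
    Real.log ‖f ((ρ * t ^ 2 : ℝ) : ℂ)‖ ≤
      Real.log A + (Real.log B - Real.log A) * (4 * t / Real.pi) := by
  have hpi := Real.pi_pos
  have hB₀ := hA₀.trans_le hAB
  have h1 : Real.arctan t ≤ Real.pi / 4 := by
    rw [← Real.arctan_one]
    exact Real.arctan_mono ht.2
  have h0 : 0 ≤ Real.arctan t := Real.arctan_nonneg.2 ht.1
  have hxt : 4 * Real.arctan t / Real.pi ≤ 4 * t / Real.pi := by
    have : Real.arctan t ≤ t := by
      simpa using Real.le_tan h0 (Real.arctan_lt_pi_div_two t)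
    gcongr
  have h := norm_le_interp_of_slit hf hρ hA hB (x := 4 * Real.arctan t / Real.pi)
    ⟨by positivity, by rw [div_le_one hpi]; linarith⟩
  rw [show Real.pi * (4 * Real.arctan t / Real.pi) / 4 = Real.arctan t by field_simp,
    Real.tan_arctan] at h
  have h2 := Real.log_le_log (norm_pos_iff.2 hft) h
  rw [Real.log_mul (Real.rpow_pos_of_pos hA₀ _).ne' (Real.rpow_pos_of_pos hB₀ _).ne',
    Real.log_rpow hA₀, Real.log_rpow hB₀] at h2
  have h3 : 0 ≤ Real.log B - Real.log A := sub_nonneg.2 (Real.log_le_log hA₀ hAB)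
  nlinarith [mul_le_mul_of_nonneg_left hxt h3]

/-! ### The length-area inequality -/

lemma abs_det_mul_eq (w : ℂ) :
    |((ContinuousLinearMap.toSpanSingleton ℂ w).restrictScalars ℝ).det| = ‖w‖ ^ 2 := by
  have : ((ContinuousLinearMap.toSpanSingleton ℂ w).restrictScalars ℝ).det = ‖w‖ ^ 2 := by
    rw [ContinuousLinearMap.det, ← LinearMap.det_toMatrix basisOneI, Matrix.det_fin_two]
    simp [LinearMap.toMatrix_apply, ← normSq_eq_norm_sq, normSq_apply]
  rw [this, abs_of_nonneg (by positivity)]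

lemma volume_reProdIm_Ioo (a b c d : ℝ) :
    volume (Ioo a b ×ℂ Ioo c d) = ENNReal.ofReal (b - a) * ENNReal.ofReal (d - c) := by
  rw [← Real.volume_Ioo, ← Real.volume_Ioo, ← Measure.prod_prod, ← Measure.volume_eq_prod,
    ← volume_preserving_equiv_real_prod.measure_preimage_equiv]
  rfl

lemma lintegral_eq_lintegral_lintegral {J : ℂ → ℝ≥0∞} (hJ : Measurable J) :
    ∫⁻ ξ, J ξ = ∫⁻ t : ℝ, ∫⁻ θ : ℝ, J (t + θ * I) := by
  rw [← (volume_preserving_equiv_real_prod.symm _).lintegral_comp_emb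
    (MeasurableEquiv.measurableEmbedding _), Measure.volume_eq_prod, lintegral_prod]
  · refine lintegral_congr fun t => lintegral_congr fun θ => ?_
    congr 1
    exact Complex.ext (by simp [measurableEquivRealProd]) (by simp [measurableEquivRealProd])
  · exact (hJ.comp (MeasurableEquiv.measurable _)).aemeasurable

/-- The area of an injective image, in terms of the complex derivative. -/
lemma lintegral_norm_deriv_sq {Φ : ℂ → ℂ} {E : Set ℂ} (hE : MeasurableSet E)
    (hΦ : ∀ ξ ∈ E, DifferentiableAt ℂ Φ ξ) (hinj : InjOn Φ E) :
    ∫⁻ ξ in E, ENNReal.ofReal (‖deriv Φ ξ‖ ^ 2) = volume (Φ '' E) := by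
  rw [← lintegral_abs_det_fderiv_eq_addHaar_image volume hE
    (fun ξ hξ => ((hΦ ξ hξ).hasDerivAt.hasFDerivAt.restrictScalars ℝ).hasFDerivWithinAt) hinj]
  simp only [abs_det_mul_eq]

/-- The Cauchy-Schwarz step of the length-area method, on one cross-cut: a real function whose
values on a set of measure at most `π` fill an interval of length `ℓ` has Dirichlet integral at
least `ℓ ^ 2 / π`. -/
lemma le_lintegral_sq_of_Ioo_subset_image {φ φ' N : ℝ → ℝ} {A : Set ℝ} (hA : MeasurableSet A)
    (hAπ : A ⊆ Ioo 0 Real.pi) (hφ : ∀ θ ∈ A, HasDerivAt φ (φ' θ) θ)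
    (hN : ∀ θ ∈ A, |φ' θ| ≤ N θ) {y₁ y₂ : ℝ} (hy : y₁ ≤ y₂) (himg : Ioo y₁ y₂ ⊆ φ '' A) :
    ENNReal.ofReal ((y₂ - y₁) ^ 2 / Real.pi) ≤ ∫⁻ θ in A, ENNReal.ofReal (N θ ^ 2) := by
  have hpi := Real.pi_pos
  set ℓ := y₂ - y₁ with hℓ
  have hℓ0 : 0 ≤ ℓ := sub_nonneg.2 hy
  have h1 : ENNReal.ofReal ℓ ≤ ∫⁻ θ in A, ENNReal.ofReal |φ' θ| := by
    have h := addHaar_image_le_lintegral_abs_det_fderiv volume hA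
      (fun θ hθ => (hφ θ hθ).hasFDerivAt.hasFDerivWithinAt)
    simp only [ContinuousLinearMap.det_toSpanSingleton] at h
    refine le_trans ?_ h
    rw [hℓ, ← Real.volume_Ioo]
    exact measure_mono himg
  have h2 : ENNReal.ofReal (2 * (ℓ / Real.pi) * ℓ) ≤
      (∫⁻ θ in A, ENNReal.ofReal (N θ ^ 2)) + ENNReal.ofReal (ℓ ^ 2 / Real.pi) := by
    calc ENNReal.ofReal (2 * (ℓ / Real.pi) * ℓ)
        = ENNReal.ofReal (2 * (ℓ / Real.pi)) * ENNReal.ofReal ℓ :=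
          ENNReal.ofReal_mul (by positivity)
      _ ≤ ENNReal.ofReal (2 * (ℓ / Real.pi)) * ∫⁻ θ in A, ENNReal.ofReal |φ' θ| := by gcongr
      _ = ∫⁻ θ in A, ENNReal.ofReal (2 * (ℓ / Real.pi)) * ENNReal.ofReal |φ' θ| :=
          (lintegral_const_mul' _ _ ENNReal.ofReal_ne_top).symm
      _ ≤ ∫⁻ θ in A, (ENNReal.ofReal (N θ ^ 2) + ENNReal.ofReal ((ℓ / Real.pi) ^ 2)) := by
          refine setLIntegral_mono' hA fun θ hθ => ?_
          rw [← ENNReal.ofReal_mul (by positivity),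
            ← ENNReal.ofReal_add (by positivity) (by positivity)]
          refine ENNReal.ofReal_le_ofReal ?_
          have hn := hN θ hθ
          have : 0 ≤ ℓ / Real.pi := by positivity
          nlinarith [sq_nonneg (N θ - ℓ / Real.pi), mul_le_mul_of_nonneg_left hn this]
      _ = (∫⁻ θ in A, ENNReal.ofReal (N θ ^ 2)) +
          ENNReal.ofReal ((ℓ / Real.pi) ^ 2) * volume A := by
          rw [lintegral_add_right _ measurable_const, setLIntegral_const]
      _ ≤ _ := by
          gcongr
          calc ENNReal.ofReal ((ℓ / Real.pi) ^ 2) * volume A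
              ≤ ENNReal.ofReal ((ℓ / Real.pi) ^ 2) * ENNReal.ofReal Real.pi := by
                gcongr
                calc volume A ≤ volume (Ioo 0 Real.pi) := measure_mono hAπ
                  _ = _ := by rw [Real.volume_Ioo, sub_zero]
            _ = ENNReal.ofReal (ℓ ^ 2 / Real.pi) := by
                rw [← ENNReal.ofReal_mul (by positivity)]
                congr 1
                field_simp
  have h3 : 2 * (ℓ / Real.pi) * ℓ = ℓ ^ 2 / Real.pi + ℓ ^ 2 / Real.pi := by ring
  rw [h3, ENNReal.ofReal_add (by positivity) (by positivity)] at h2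
  exact (ENNReal.add_le_add_iff_right ENNReal.ofReal_ne_top).1 h2

/-- The length-area inequality. Let `F` be univalent in the rectangle `t₁ < Re ξ < t₂`,
`0 < Im ξ < π`, and suppose that every vertical segment, followed from a point with `U ≤ |F|` on the
real axis, reaches a point with `|F| ≤ σ` while `Re F` stays positive. The images of these segments
cross the half annulus `σ < |w| < U`, `Re w > 0`, so the extremal length of the family of segments,
`π / (t₂ - t₁)`, is at least `log (U / σ) / π`. The upper end `Im ξ = π` is allowed for the end of a
segment, where `F` need not be differentiable. -/
lemma length_mul_log_le {F : ℂ → ℂ} {t₁ t₂ σ U : ℝ} (hσ : 0 < σ) (hσU : σ < U)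
    (hF : DifferentiableOn ℂ F (Ioo t₁ t₂ ×ℂ Ioo 0 Real.pi))
    (hinj : InjOn F (Ioo t₁ t₂ ×ℂ Ioo 0 Real.pi))
    (hcross : ∀ t ∈ Ioo t₁ t₂, ∃ θ' ∈ Icc 0 Real.pi,
      ContinuousOn (fun θ : ℝ => F (t + θ * I)) (Icc 0 θ') ∧
      (∀ θ ∈ Icc 0 θ', 0 < (F (t + θ * I)).re) ∧ U ≤ ‖F t‖ ∧ ‖F (t + θ' * I)‖ ≤ σ) :
    (t₂ - t₁) * Real.log (U / σ) ≤ Real.pi ^ 2 := by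
  have hpi := Real.pi_pos
  have hU : 0 < U := hσ.trans hσU
  have hlog : Real.log σ < Real.log U := Real.log_lt_log hσ hσU
  set ℓ := Real.log U - Real.log σ with hℓ
  have hℓ0 : 0 < ℓ := sub_pos.2 hlog
  set S : Set ℂ := Ioo t₁ t₂ ×ℂ Ioo 0 Real.pi with hS
  have hSo : IsOpen S := isOpen_Ioo.reProdIm isOpen_Ioo
  set E : Set ℂ := S ∩ F ⁻¹' {w | 0 < w.re ∧ σ < ‖w‖ ∧ ‖w‖ < U} with hE
  have hEo : IsOpen E := by
    refine hF.continuousOn.isOpen_inter_preimage hSo ?_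
    exact (isOpen_lt continuous_const continuous_re).inter
      ((isOpen_lt continuous_const continuous_norm).inter
        (isOpen_lt continuous_norm continuous_const))
  set Φ : ℂ → ℂ := fun ξ => log (F ξ) with hΦ
  have hΦd : ∀ ξ ∈ E, DifferentiableAt ℂ Φ ξ := fun ξ hξ =>
    (hF.differentiableAt (hSo.mem_nhds hξ.1)).clog (Or.inl hξ.2.1)
  have hne : ∀ ξ ∈ E, F ξ ≠ 0 := fun ξ hξ h0 => by
    have := hξ.2.1
    simp [h0] at this
  have hΦinj : InjOn Φ E := by
    intro x hx y hy hxy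
    refine hinj hx.1 hy.1 ?_
    rw [← exp_log (hne x hx), ← exp_log (hne y hy)]
    exact congrArg exp hxy
  have harea : ∫⁻ ξ in E, ENNReal.ofReal (‖deriv Φ ξ‖ ^ 2) ≤ ENNReal.ofReal (ℓ * Real.pi) := by
    rw [lintegral_norm_deriv_sq hEo.measurableSet hΦd hΦinj]
    have hsub : Φ '' E ⊆ Ioo (Real.log σ) (Real.log U) ×ℂ Ioo (-(Real.pi / 2)) (Real.pi / 2) := by
      rintro _ ⟨ξ, hξ, rfl⟩
      obtain ⟨h1, h2, h3⟩ := hξ.2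
      refine ⟨?_, ?_⟩
      · simp only [Φ, mem_preimage, log_re]
        exact ⟨Real.log_lt_log hσ h2, Real.log_lt_log (hσ.trans h2) h3⟩
      · simp only [Φ, mem_preimage, log_im]
        exact abs_lt.1 (abs_arg_lt_pi_div_two_iff.2 (Or.inl h1))
    refine (measure_mono hsub).trans_eq ?_
    rw [volume_reProdIm_Ioo, ← ENNReal.ofReal_mul hℓ0.le]
    congr 1
    ring
  set J : ℂ → ℝ≥0∞ := E.indicator fun ξ => ENNReal.ofReal (‖deriv Φ ξ‖ ^ 2) with hJ
  have hJm : Measurable J :=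
    (((measurable_deriv Φ).norm.pow_const 2).ennreal_ofReal).indicator hEo.measurableSet
  rw [← lintegral_indicator hEo.measurableSet, lintegral_eq_lintegral_lintegral hJm] at harea
  have hline : ∀ t ∈ Ioo t₁ t₂,
      ENNReal.ofReal (ℓ ^ 2 / Real.pi) ≤ ∫⁻ θ : ℝ, J (t + θ * I) := by
    intro t ht
    obtain ⟨θ', hθ', hc, hpos, hbeg, hend⟩ := hcross t ht
    set A : Set ℝ := (fun θ : ℝ => (t + θ * I : ℂ)) ⁻¹' E with hA
    have hAm : MeasurableSet A := (hEo.preimage (by fun_prop)).measurableSet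
    have hbound := le_lintegral_sq_of_Ioo_subset_image (φ := fun θ : ℝ => (Φ (t + θ * I)).re)
      (φ' := fun θ : ℝ => (deriv Φ (t + θ * I) * I).re)
      (N := fun θ : ℝ => ‖deriv Φ (t + θ * I)‖) hAm ?_ ?_ ?_ hlog.le ?_
    · refine hbound.trans_eq ?_
      rw [← lintegral_indicator hAm]
      rfl
    · intro θ hθ
      simpa using hθ.1.2
    · intro θ hθ
      have h1 : HasDerivAt (fun θ : ℝ => (t + θ * I : ℂ)) I θ := by
        simpa using ((hasDerivAt_id θ).ofReal_comp.mul_const I).const_add (t : ℂ)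
      have h2 := (hΦd _ hθ).hasDerivAt.comp θ h1
      exact reCLM.hasFDerivAt.comp_hasDerivAt θ h2
    · intro θ hθ
      refine (abs_re_le_norm _).trans ?_
      simp
    · intro y hy
      have hφ : ∀ θ : ℝ, (Φ (t + θ * I)).re = Real.log ‖F (t + θ * I)‖ := fun θ => log_re _
      have hnz : ∀ θ ∈ Icc 0 θ', 0 < ‖F (t + θ * I)‖ := fun θ hθ => by
        refine norm_pos_iff.2 fun h0 => ?_
        have := hpos θ hθ
        simp [h0] at this
      have hcont : ContinuousOn (fun θ : ℝ => Real.log ‖F (t + θ * I)‖) (Icc 0 θ') :=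
        hc.norm.log fun θ hθ => (hnz θ hθ).ne'
      have hstart : Real.log U ≤ Real.log ‖F (t + (0 : ℝ) * I)‖ :=
        Real.log_le_log hU (by simpa using hbeg)
      have hfin : Real.log ‖F (t + θ' * I)‖ ≤ Real.log σ :=
        Real.log_le_log (hnz θ' ⟨hθ'.1, le_rfl⟩) hend
      obtain ⟨θ, hθ, hval⟩ := intermediate_value_Icc' hθ'.1 hcont
        ⟨hfin.trans hy.1.le, hy.2.le.trans hstart⟩
      simp only at hval
      have hθ0 : θ ≠ 0 := by
        rintro rfl
        linarith [hy.2]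
      have hθ1 : θ ≠ θ' := by
        rintro rfl
        linarith [hy.1]
      have h0 : 0 < θ := lt_of_le_of_ne hθ.1 hθ0.symm
      have h1 : θ < Real.pi := (lt_of_le_of_ne hθ.2 hθ1).trans_le hθ'.2
      refine ⟨θ, ⟨⟨by simpa using ht, by simpa using ⟨h0, h1⟩⟩, hpos θ hθ, ?_, ?_⟩, ?_⟩
      · exact (Real.log_lt_log_iff hσ (hnz θ hθ)).1 (hval ▸ hy.1)
      · exact (Real.log_lt_log_iff (hnz θ hθ) hU).1 (hval ▸ hy.2)
      · simp only [hφ, hval]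
  have htotal : ENNReal.ofReal (ℓ ^ 2 / Real.pi * (t₂ - t₁)) ≤ ENNReal.ofReal (ℓ * Real.pi) := by
    calc ENNReal.ofReal (ℓ ^ 2 / Real.pi * (t₂ - t₁))
        = ENNReal.ofReal (ℓ ^ 2 / Real.pi) * volume (Ioo t₁ t₂) := by
          rw [Real.volume_Ioo, ENNReal.ofReal_mul (by positivity)]
      _ = ∫⁻ _ in Ioo t₁ t₂, ENNReal.ofReal (ℓ ^ 2 / Real.pi) := (setLIntegral_const _ _).symm
      _ ≤ ∫⁻ t in Ioo t₁ t₂, ∫⁻ θ : ℝ, J (t + θ * I) := setLIntegral_mono' measurableSet_Ioo hline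
      _ ≤ ∫⁻ t : ℝ, ∫⁻ θ : ℝ, J (t + θ * I) := setLIntegral_le_lintegral _ _
      _ ≤ _ := harea
  rw [ENNReal.ofReal_le_ofReal_iff (by positivity), div_mul_eq_mul_div, div_le_iff₀ hpi] at htotal
  rw [Real.log_div hU.ne' hσ.ne', ← hℓ]
  nlinarith

/-! ### Univalence of the logarithm of `f` in the upper half-plane -/

/-- The Noshiro-Warschawski criterion, with the strict inequality relaxed by the open mapping
theorem. -/
lemma injOn_of_deriv_im_nonneg {F : ℂ → ℂ} {Ω : Set ℂ} (hΩ : IsOpen Ω) (hconv : Convex ℝ Ω)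
    (hF : DifferentiableOn ℂ F Ω) (hnonneg : ∀ ξ ∈ Ω, 0 ≤ (deriv F ξ).im)
    (hne : ∃ ξ ∈ Ω, (deriv F ξ).im ≠ 0) : InjOn F Ω := by
  have hpos : ∀ ξ ∈ Ω, 0 < (deriv F ξ).im := by
    have han : AnalyticOnNhd ℂ (deriv F) Ω := (hF.deriv hΩ).analyticOnNhd hΩ
    rcases han.is_constant_or_isOpen hconv.isPreconnected with ⟨w, hw⟩ | hopen
    · obtain ⟨ξ₀, hξ₀, h0⟩ := hne
      intro ξ hξ
      rw [hw ξ hξ, ← hw ξ₀ hξ₀]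
      exact lt_of_le_of_ne (hnonneg ξ₀ hξ₀) h0.symm
    · intro ξ hξ
      have hsub : deriv F '' Ω ⊆ interior {w : ℂ | 0 ≤ w.im} :=
        interior_maximal (by rintro _ ⟨ξ, hξ, rfl⟩; exact hnonneg ξ hξ) (hopen Ω subset_rfl hΩ)
      rw [interior_setOfPred_le_im] at hsub
      exact hsub ⟨ξ, hξ, rfl⟩
  intro x hx y hy hxy
  by_contra hne
  have hd : y - x ≠ 0 := sub_ne_zero.2 (Ne.symm hne)
  have hmem : ∀ τ ∈ Icc (0 : ℝ) 1, x + τ * (y - x) ∈ Ω := by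
    intro τ hτ
    have := hconv.add_smul_sub_mem hx hy hτ
    simpa using this
  have hderiv : ∀ τ ∈ Icc (0 : ℝ) 1,
      HasDerivAt (fun τ : ℝ => (F (x + τ * (y - x)) / (y - x)).im)
        (deriv F (x + τ * (y - x))).im τ := by
    intro τ hτ
    have h1 : HasDerivAt (fun τ : ℝ => (x + τ * (y - x) : ℂ)) (y - x) τ := by
      simpa using ((hasDerivAt_id τ).ofReal_comp.mul_const (y - x)).const_add x
    have h2 := (hF.differentiableAt (hΩ.mem_nhds (hmem τ hτ))).hasDerivAt.comp τ h1
    have h3 := imCLM.hasFDerivAt.comp_hasDerivAt τ (h2.div_const (y - x))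
    rw [mul_div_cancel_right₀ _ hd] at h3
    exact h3
  have hmono : StrictMonoOn (fun τ : ℝ => (F (x + τ * (y - x)) / (y - x)).im) (Icc 0 1) := by
    refine strictMonoOn_of_deriv_pos (convex_Icc 0 1)
      (fun τ hτ => (hderiv τ hτ).continuousAt.continuousWithinAt) fun τ hτ => ?_
    rw [interior_Icc] at hτ
    have hτ' := Ioo_subset_Icc_self hτ
    rw [(hderiv τ hτ').deriv]
    exact hpos _ (hmem τ hτ')
  have := hmono ⟨le_rfl, zero_le_one⟩ ⟨zero_le_one, le_rfl⟩ zero_lt_one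
  simp [hxy] at this

lemma ofReal_add_ofReal_mul_I_mem {t₁ t₂ t θ : ℝ} {s : Set ℝ} (ht : t ∈ Ioo t₁ t₂) (hθ : θ ∈ s) :
    (t + θ * I : ℂ) ∈ Ioo t₁ t₂ ×ℂ s := by
  simpa [mem_reProdIm] using And.intro ht hθ

lemma exp_im_nonneg {t θ : ℝ} (hθ : θ ∈ Icc 0 Real.pi) : 0 ≤ (exp (t + θ * I)).im := by
  rw [exp_im]
  simpa using mul_nonneg (Real.exp_pos t).le (Real.sin_nonneg_of_mem_Icc hθ)

lemma IsLogBranchAround.re_eq {f g : ℂ → ℂ} {Γ G : Set ℂ} (hg : IsLogBranchAround f Γ G g) {z : ℂ}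
    (hz : z ∈ G) : (g z).re = Real.log ‖f z‖ := by
  rw [← hg.exp_eq z hz, norm_exp, Real.log_exp]

section

variable {f g : ℂ → ℂ} {c : ℝ} {p₀ : ℕ} {p : ℕ → ℕ} {a : ℕ → ℝ}

lemma HasSymmetricProduct.antitoneOn_norm_exp (h : HasSymmetricProduct f c p₀ p a) (t : ℝ) :
    AntitoneOn (fun θ : ℝ => ‖f (exp (t + θ * I))‖) (Icc 0 Real.pi) := by
  have := h.antitoneOn_norm (Real.exp_pos t).le
  simpa only [exp_add, ofReal_exp] using this

lemma exp_mem_logDomain (h : HasSymmetricProduct f c p₀ p a) (hd : Differentiable ℂ f) {t θ : ℝ}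
    (hθ : θ ∈ Ioo 0 Real.pi) : exp (t + θ * I) ∈ logDomain f := by
  refine mem_logDomain (exp_im_nonneg (Ioo_subset_Icc_self hθ)) fun h0 => ?_
  have h1 := (h.eq_zero_imp hd h0).1
  rw [exp_im] at h1
  have h2 : 0 < Real.exp t * Real.sin θ :=
    mul_pos (Real.exp_pos t) (Real.sin_pos_of_mem_Ioo hθ)
  simp at h1
  exact (Real.sin_pos_of_mem_Ioo hθ).ne' h1

lemma exp_mem_logDomain_of_mem_reProdIm (h : HasSymmetricProduct f c p₀ p a)
    (hd : Differentiable ℂ f) {t₁ t₂ : ℝ} {ξ : ℂ} (hξ : ξ ∈ Ioo t₁ t₂ ×ℂ Ioo 0 Real.pi) :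
    exp ξ ∈ logDomain f := by
  rw [← re_add_im ξ]
  exact exp_mem_logDomain h hd hξ.2

lemma differentiableOn_log_comp_exp (h : HasSymmetricProduct f c p₀ p a)
    (hd : Differentiable ℂ f) (hg : IsLogBranchAround f (logDomain f) (logDomain f) g) (t₁ t₂ : ℝ) :
    DifferentiableOn ℂ (fun ξ => g (exp ξ)) (Ioo t₁ t₂ ×ℂ Ioo 0 Real.pi) :=
  hg.differentiableOn.comp differentiable_exp.differentiableOn
    fun _ hξ => exp_mem_logDomain_of_mem_reProdIm h hd hξ

/-- In the coordinate `ξ = log z`, the derivative of `log f` has non-negative imaginary part, because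
`|f|` decreases on half circles. -/
lemma injOn_log_comp_exp (h : HasSymmetricProduct f c p₀ p a) (hd : Differentiable ℂ f)
    (hg : IsLogBranchAround f (logDomain f) (logDomain f) g) {t₁ t₂ : ℝ}
    (hdec : ∃ t ∈ Ioo t₁ t₂, ‖f ((-Real.exp t : ℝ) : ℂ)‖ < ‖f ((Real.exp t : ℝ) : ℂ)‖) :
    InjOn (fun ξ => g (exp ξ)) (Ioo t₁ t₂ ×ℂ Ioo 0 Real.pi) := by
  have hpi := Real.pi_pos
  have hF := differentiableOn_log_comp_exp h hd hg t₁ t₂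
  set F : ℂ → ℂ := fun ξ => g (exp ξ) with hFdef
  set S : Set ℂ := Ioo t₁ t₂ ×ℂ Ioo 0 Real.pi with hS
  have hSo : IsOpen S := isOpen_Ioo.reProdIm isOpen_Ioo
  have hderiv : ∀ t ∈ Ioo t₁ t₂, ∀ θ ∈ Ioo 0 Real.pi,
      HasDerivAt (fun θ : ℝ => ‖f (exp (t + θ * I))‖)
        (‖f (exp (t + θ * I))‖ * -(deriv F (t + θ * I)).im) θ := by
    intro t ht θ hθ
    have h1 : HasDerivAt (fun θ : ℝ => (t + θ * I : ℂ)) I θ := by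
      simpa using ((hasDerivAt_id θ).ofReal_comp.mul_const I).const_add (t : ℂ)
    have h2 := (hF.differentiableAt
      (hSo.mem_nhds (ofReal_add_ofReal_mul_I_mem ht hθ))).hasDerivAt.comp θ h1
    have h3 := (reCLM.hasFDerivAt.comp_hasDerivAt θ h2).exp
    have hnorm : ∀ θ ∈ Ioo 0 Real.pi,
        ‖f (exp (t + θ * I))‖ = Real.exp (F (t + θ * I)).re := by
      intro θ hθ
      rw [← norm_exp, hFdef, hg.exp_eq _ (exp_mem_logDomain h hd hθ)]
    rw [hnorm θ hθ]
    have h4 : (fun θ : ℝ => ‖f (exp (t + θ * I))‖) =ᶠ[𝓝 θ]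
        fun θ : ℝ => Real.exp (F (t + θ * I)).re := by
      filter_upwards [isOpen_Ioo.mem_nhds hθ] with θ' hθ' using hnorm θ' hθ'
    have h5 := h3.congr_of_eventuallyEq h4
    simpa using h5
  have hnormpos : ∀ t : ℝ, ∀ θ ∈ Ioo 0 Real.pi, 0 < ‖f (exp (t + θ * I))‖ := fun t θ hθ =>
    norm_pos_iff.2 (hg.ne_zero _ (exp_mem_logDomain h hd hθ))
  refine injOn_of_deriv_im_nonneg hSo
    (((convex_Ioo t₁ t₂).linear_preimage reCLM.toLinearMap).inter
      ((convex_Ioo 0 Real.pi).linear_preimage imCLM.toLinearMap)) hF ?_ ?_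
  · intro ξ hξ
    have h1 := hderiv ξ.re hξ.1 ξ.im hξ.2
    have h2 := ((h.antitoneOn_norm_exp ξ.re).mono Ioo_subset_Icc_self).derivWithin_nonpos
      (x := ξ.im)
    rw [derivWithin_of_isOpen isOpen_Ioo hξ.2, h1.deriv, re_add_im] at h2
    have h3 := hnormpos ξ.re ξ.im hξ.2
    rw [re_add_im] at h3
    nlinarith
  · by_contra! hall
    obtain ⟨t, ht, hlt⟩ := hdec
    have hcont : ContinuousOn (fun θ : ℝ => ‖f (exp (t + θ * I))‖) (Icc 0 Real.pi) :=
      (hd.continuous.comp (by fun_prop)).norm.continuousOn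
    have hmono := monotoneOn_of_deriv_nonneg (convex_Icc 0 Real.pi) hcont
      (fun θ hθ => (hderiv t ht θ (by simpa using hθ)).differentiableAt.differentiableWithinAt)
      (fun θ hθ => by
        rw [interior_Icc] at hθ
        rw [(hderiv t ht θ hθ).deriv, hall _ (ofReal_add_ofReal_mul_I_mem ht hθ)]
        simp)
    have := hmono ⟨le_rfl, hpi.le⟩ ⟨hpi.le, le_rfl⟩ hpi.le
    simp only [ofReal_zero, zero_mul, add_zero, exp_add, exp_pi_mul_I, mul_neg, mul_one] at this
    rw [← ofReal_exp, ← ofReal_neg] at this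
    exact absurd this (not_le.2 hlt)

end

/-! ### Numerical estimates -/

lemma log_ge_of_two_pow_le {y : ℝ} {m n : ℕ} (hm : 0 < m) (h : (2 : ℝ) ^ n ≤ y ^ m) :
    (n : ℝ) / m * 0.6931 ≤ Real.log y := by
  have h1 := Real.log_le_log (by positivity) h
  rw [Real.log_pow, Real.log_pow] at h1
  have hm' : (0 : ℝ) < m := by exact_mod_cast hm
  rw [div_mul_eq_mul_div, div_le_iff₀ hm']
  nlinarith [Real.log_two_gt_d9, (Nat.cast_nonneg n : (0 : ℝ) ≤ n)]

/-- The inequality that closes the length-area argument; `L` is the logarithmic length of the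
annulus, and the other quantities are measured in units of `s ^ (b / 4) log M(R) / log R`. -/
lemma pi_sq_lt_mul_log {L τ d e : ℝ} (hL : 6.12 ≤ L) (hτ : 0 ≤ τ) (hτL : τ ≤ 0.01158 * L)
    (hd : 0.5778 ≤ d) (he : 0 < e) (he' : e ≤ 0.0727) :
    Real.pi ^ 2 < L * Real.log ((τ + d) / √(τ ^ 2 + e ^ 2)) := by
  have hpi : Real.pi ^ 2 < 9.87 := by nlinarith [Real.pi_lt_d4, Real.pi_gt_d4]
  refine hpi.trans ?_
  set y : ℝ := (τ + d) ^ 2 / (τ ^ 2 + e ^ 2) with hy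
  have hden : 0 < τ ^ 2 + e ^ 2 := by positivity
  have hy0 : 0 < y := by positivity
  have hlog : Real.log ((τ + d) / √(τ ^ 2 + e ^ 2)) = Real.log y / 2 := by
    rw [hy, ← Real.sq_sqrt hden.le, ← div_pow, Real.log_pow, Real.sqrt_sq (Real.sqrt_nonneg _)]
    push_cast
    ring
  have he2 : e ^ 2 ≤ 0.005286 := by nlinarith
  have hnum : (τ + 0.5778) ^ 2 ≤ (τ + d) ^ 2 := by gcongr
  rw [hlog]
  rcases le_total τ 0.1 with h1 | h1
  · have : 27 ≤ y := by
      rw [hy, le_div_iff₀ hden]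
      nlinarith
    have := log_ge_of_two_pow_le (m := 4) (n := 19) (by norm_num)
      (le_trans (by norm_num) (pow_le_pow_left₀ (by norm_num) this 4))
    norm_num at this
    nlinarith
  have hL8 : 8.63 ≤ L := by linarith
  rcases le_total τ 0.2 with h2 | h2
  · have : 11.4 ≤ y := by
      rw [hy, le_div_iff₀ hden]
      nlinarith
    have := log_ge_of_two_pow_le (m := 2) (n := 7) (by norm_num)
      (le_trans (by norm_num) (pow_le_pow_left₀ (by norm_num) this 2))
    norm_num at this
    nlinarith
  have hL17 : 17.2 ≤ L := by linarith
  rcases le_total τ 0.35 with h3 | h3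
  · have : 4 ≤ y := by
      rw [hy, le_div_iff₀ hden]
      nlinarith
    have := log_ge_of_two_pow_le (m := 1) (n := 2) (by norm_num)
      (le_trans (by norm_num) (pow_le_pow_left₀ (by norm_num) this 1))
    norm_num at this
    nlinarith
  · have h4 := Real.one_sub_inv_le_log_of_pos hy0
    have h5 : 0.2287 / τ ≤ 1 - y⁻¹ := by
      have hτ0 : 0 < τ := by linarith
      have hd0 : 0 < (τ + d) ^ 2 := by positivity
      rw [hy, inv_div, div_le_iff₀ hτ0, one_sub_div hd0.ne', div_mul_eq_mul_div, le_div_iff₀ hd0]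
      nlinarith [mul_nonneg (sub_nonneg.2 hd) (sub_nonneg.2 h3),
        mul_nonneg (sub_nonneg.2 hd) hτ, mul_nonneg (mul_nonneg (sub_nonneg.2 hd) hτ) hτ,
        mul_nonneg (sq_nonneg (d - 0.5778)) hτ,
        mul_nonneg (sq_nonneg (d - 0.5778)) (sub_nonneg.2 h3), sq_nonneg (τ - 0.35)]
    have h6 : 0.2287 / 0.01158 ≤ L * (0.2287 / τ) := by
      have hτ0 : 0 < τ := by linarith
      rw [← mul_div_assoc, div_le_div_iff₀ (by norm_num) hτ0]
      nlinarith
    have h7 : L * (0.2287 / τ) ≤ L * Real.log y := by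
      have : 0.2287 / τ ≤ Real.log y := h5.trans h4
      gcongr
    norm_num at h6
    linarith

lemma sqrt_two_bounds : 1.4142 < √2 ∧ √2 < 1.4143 :=
  ⟨Real.lt_sqrt_of_sq_lt (by norm_num), (Real.sqrt_lt' (by norm_num)).2 (by norm_num)⟩

lemma lt_fortyeight_mul_sqrt_two_div_pi : 21.6 < 48 * √2 / Real.pi := by
  rw [lt_div_iff₀ Real.pi_pos]
  nlinarith [sqrt_two_bounds.1, Real.pi_lt_d4]

lemma log_ge_of_ge {X : ℝ} (hX : 21.6 ≤ X) : 3.06 ≤ Real.log X := by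
  rw [Real.le_log_iff_exp_le (by linarith)]
  refine le_trans ?_ hX
  have h1 : Real.exp 3.06 = Real.exp 1 ^ 3 * Real.exp 0.06 := by
    rw [← Real.exp_nat_mul, ← Real.exp_add]
    norm_num
  have h2 : Real.exp 0.06 ≤ 1 / 0.94 := by
    have := Real.one_sub_le_exp_neg 0.06
    rw [Real.exp_neg] at this
    rw [le_div_iff₀ (by norm_num)]
    have h0 := Real.exp_pos 0.06
    rw [← one_div, le_div_iff₀ h0] at this
    linarith
  have h3 : Real.exp 1 ^ 3 ≤ 2.71829 ^ 3 :=
    pow_le_pow_left₀ (Real.exp_pos 1).le (by linarith [Real.exp_one_lt_d9]) 3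
  rw [h1]
  calc _ ≤ (2.71829 : ℝ) ^ 3 * (1 / 0.94) := by gcongr
    _ ≤ 21.6 := by norm_num

/-! ### The winding of the image -/

section

variable {f g : ℂ → ℂ} {c : ℝ} {p₀ : ℕ} {p : ℕ → ℕ} {a : ℕ → ℝ}

/-- If `|f| ≤ M(R)` on a long negative segment, then `log M` grows like a square root: at
`R X ^ 2` it exceeds `log M(R)` by a multiple of `X log M(R) / log R`. -/
lemma growth_of_slit (h : HasSymmetricProduct f c p₀ p a) (hd : Differentiable ℂ f) {R X T : ℝ}
    (hR : 1 < R) (hT : T = Real.log (maxMod f R)) (hT0 : 0 < T) (hX : 21.6 ≤ X)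
    (hHad : ∀ x, R ≤ x → T * Real.log x / Real.log R ≤ Real.log (maxMod f x))
    (hslit : ∀ x ∈ Icc 0 (R * X ^ 2), ‖f ((-x : ℝ) : ℂ)‖ ≤ maxMod f R) :
    0.5778 * (X * T / Real.log R) ≤ Real.log (maxMod f (R * X ^ 2)) - T := by
  have hpi := Real.pi_pos
  have hlogR : 0 < Real.log R := Real.log_pos hR
  have hR0 : 0 < R := by linarith
  have hX0 : 0 < X := by linarith
  have he0 := Real.exp_pos 1
  have he : Real.exp 1 < 2.71829 := by linarith [Real.exp_one_lt_d9]
  have hmono : maxMod f R ≤ maxMod f (R * X ^ 2) := by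
    rw [h.maxMod_eq hR0.le, h.maxMod_eq (by positivity)]
    refine h.monotoneOn_norm (mem_Ici.2 hR0.le) (mem_Ici.2 (by positivity)) ?_
    exact le_mul_of_one_le_right hR0.le (one_le_pow₀ (by linarith))
  -- Radius `R e ^ 2` gives the best constant, because `log t / √t` is largest at `t = e ^ 2`.
  have ht : R * X ^ 2 * (Real.exp 1 / X) ^ 2 = R * Real.exp 1 ^ 2 := by
    field_simp
  have hpos : 0 < R * Real.exp 1 ^ 2 := by positivity
  have h1 := log_norm_le_of_slit hd (ρ := R * X ^ 2) (A := maxMod f R)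
    (B := maxMod f (R * X ^ 2)) (by positivity) (h.maxMod_pos hR0) hmono hslit
    (fun z hz => h.norm_le_maxMod hz) (t := Real.exp 1 / X)
    ⟨by positivity, (div_le_one hX0).2 (by linarith)⟩
    (by rw [ht]; exact h.ne_zero_of_pos hpos)
  rw [ht, ← h.maxMod_eq hpos.le, ← hT] at h1
  have h2 := hHad (R * Real.exp 1 ^ 2) (by
    have : 1 ≤ Real.exp 1 ^ 2 := one_le_pow₀ (Real.one_le_exp zero_le_one)
    nlinarith)
  rw [Real.log_mul hR0.ne' (by positivity), Real.log_pow, Real.log_exp] at h2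
  have h3 : T * (Real.log R + (2 : ℕ) * 1) / Real.log R = T + 2 * (T / Real.log R) := by
    push_cast
    field_simp
  rw [h3] at h2
  set D := Real.log (maxMod f (R * X ^ 2)) - T with hD
  have hK : 0 < T / Real.log R := by positivity
  have h4 : 2 * (T / Real.log R) ≤ D * (4 * (Real.exp 1 / X) / Real.pi) := by linarith
  have h5 : 2 * (X * T / Real.log R) * Real.pi ≤ D * (4 * Real.exp 1) := by
    have : D * (4 * (Real.exp 1 / X) / Real.pi) * (X * Real.pi) = D * (4 * Real.exp 1) := by
      field_simp
    rw [← this]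
    refine le_trans (le_of_eq ?_) (mul_le_mul_of_nonneg_right h4 (by positivity))
    ring
  have hQ : 0 < X * T / Real.log R := by positivity
  have hD0 : 0 < D := by
    by_contra! hcon
    nlinarith [mul_pos hQ hpi]
  nlinarith [Real.pi_gt_d4, mul_lt_mul_of_pos_left he hD0]

set_option maxHeartbeats 1000000 in
/-- The lower bound for the oscillation of the argument on a set that meets all circles in an
annulus of moduli ratio `X ^ 2` and on which `1 < |f| ≤ M(R)`. -/
lemma le_im_sub_im (h : HasSymmetricProduct f c p₀ p a) (hd : Differentiable ℂ f)
    (hg : IsLogBranchAround f (logDomain f) (logDomain f) g) {R X T : ℝ}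
    (hR : 1 < R) (hT : T = Real.log (maxMod f R)) (hT0 : 0 < T) (hX : 48 * √2 / Real.pi ≤ X)
    (hRX : 384 * √2 / Real.pi * Real.log R ≤ 4 * X * Real.log X)
    (hHad : ∀ x, R ≤ x → T * Real.log x / Real.log R ≤ Real.log (maxMod f x))
    (hslit : ∀ x ∈ Icc 0 (R * X ^ 2), ‖f ((-x : ℝ) : ℂ)‖ ≤ maxMod f R)
    {Γ : Set ℂ} (hup : Γ ⊆ {z : ℂ | 0 ≤ z.im}) (hlow : ∀ z ∈ Γ, 1 < ‖f z‖)
    (hhigh : ∀ z ∈ Γ, ‖f z‖ ≤ maxMod f R)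
    (hcircle : ∀ r ∈ Ioo (R * X ^ 2) (R * X ^ 4), ∃ z ∈ Γ, ‖z‖ = r)
    {z₀ z₀' : ℂ} (hz : ∀ z ∈ Γ, (g z₀).im ≤ (g z).im ∧ (g z).im ≤ (g z₀').im) :
    Real.pi ^ 2 * X * T / (48 * √2 * Real.log R) ≤ (g z₀').im - (g z₀).im := by
  by_contra! hcon
  have hpi := Real.pi_pos
  have hs2 := sqrt_two_bounds
  have hlogR : 0 < Real.log R := Real.log_pos hR
  have hR0 : 0 < R := by linarith
  have hX21 : 21.6 ≤ X := lt_fortyeight_mul_sqrt_two_div_pi.le.trans hX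
  have hX0 : 0 < X := by linarith
  have hlogX := log_ge_of_ge hX21
  set Q := X * T / Real.log R with hQ
  have hQ0 : 0 < Q := by positivity
  set D := Real.log (maxMod f (R * X ^ 2)) - T with hD
  have hDQ : 0.5778 * Q ≤ D := growth_of_slit h hd hR hT hT0 hX21 hHad hslit
  have hD0 : 0 < D := by linarith
  set e := Real.pi ^ 2 / (96 * √2) with he
  have he0 : 0 < e := by positivity
  have hee : e ≤ 0.0727 := by
    rw [he, div_le_iff₀ (by positivity)]
    nlinarith [Real.pi_lt_d4, Real.pi_gt_d4]
  have hδ : (g z₀').im - (g z₀).im < 2 * (e * Q) := by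
    refine hcon.trans_eq ?_
    rw [he, hQ]
    field_simp
    norm_num
  -- In the units of `Q`, the range of `log |f|` on `Γ` is small compared with the length.
  have hτ : T / Q ≤ 0.01158 * (2 * Real.log X) := by
    have e1 : T / Q = Real.log R / X := by
      rw [hQ]
      field_simp
    rw [e1, div_le_iff₀ hX0]
    rw [div_mul_eq_mul_div, div_le_iff₀ hpi] at hRX
    have h1 : Real.pi * (X * Real.log X) ≤ 3.1416 * (X * Real.log X) := by
      have : 0 ≤ X * Real.log X := by positivity
      nlinarith [Real.pi_lt_d4]
    have h2 : 384 * 1.4142 * Real.log R ≤ 384 * √2 * Real.log R := by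
      have := hs2.1.le
      gcongr
    have h3 : 0 ≤ X * Real.log X := by positivity
    nlinarith
  set σ := √(T ^ 2 + (e * Q) ^ 2) with hσ
  have hσ0 : 0 < σ := Real.sqrt_pos.2 (by positivity)
  have hratio : (T / Q + D / Q) / √((T / Q) ^ 2 + e ^ 2) = (T + D) / σ := by
    have : (T / Q) ^ 2 + e ^ 2 = (T ^ 2 + (e * Q) ^ 2) / Q ^ 2 := by field_simp
    rw [this, Real.sqrt_div (by positivity), Real.sqrt_sq hQ0.le, ← add_div,
      div_div_div_cancel_right₀ hQ0.ne']
  have hnum := pi_sq_lt_mul_log (L := 2 * Real.log X) (τ := T / Q) (d := D / Q) (e := e)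
    (by linarith) (by positivity) hτ (by rwa [le_div_iff₀ hQ0]) he0 hee
  rw [hratio] at hnum
  have hσU : σ < T + D := by
    have h1 : 0 < Real.log ((T + D) / σ) := by
      by_contra! hle
      nlinarith [sq_nonneg Real.pi]
    rwa [Real.log_pos_iff (by positivity), one_lt_div hσ0] at h1
  set t₁ := Real.log (R * X ^ 2) with ht₁
  set t₂ := Real.log (R * X ^ 4) with ht₂
  have hlen : t₂ - t₁ = 2 * Real.log X := by
    rw [ht₁, ht₂, Real.log_mul hR0.ne' (by positivity), Real.log_mul hR0.ne' (by positivity),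
      Real.log_pow, Real.log_pow]
    push_cast
    ring
  have hradius : ∀ t ∈ Ioo t₁ t₂, Real.exp t ∈ Ioo (R * X ^ 2) (R * X ^ 4) := by
    intro t ht
    exact ⟨(Real.log_lt_iff_lt_exp (by positivity)).1 ht.1,
      (Real.lt_log_iff_exp_lt (by positivity)).1 ht.2⟩
  have hMexp : ∀ t ∈ Ioo t₁ t₂, T + D ≤ Real.log ‖f ((Real.exp t : ℝ) : ℂ)‖ := by
    intro t ht
    have h1 : 0 < R * X ^ 2 := by positivity
    rw [hD, add_sub_cancel, h.maxMod_eq h1.le]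
    exact Real.log_le_log (norm_pos_iff.2 (h.ne_zero_of_pos h1))
      (h.monotoneOn_norm (mem_Ici.2 h1.le) (mem_Ici.2 (Real.exp_pos t).le) (hradius t ht).1.le)
  have hlogle : ∀ z ∈ Γ, Real.log ‖f z‖ ≤ T := fun z hz => by
    rw [hT]
    exact Real.log_le_log (by linarith [hlow z hz]) (hhigh z hz)
  have hinj := injOn_log_comp_exp h hd hg (t₁ := t₁) (t₂ := t₂) (by
    have ht : (t₁ + t₂) / 2 ∈ Ioo t₁ t₂ := by constructor <;> linarith
    refine ⟨_, ht, ?_⟩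
    obtain ⟨z, hzΓ, hzn⟩ := hcircle _ (hradius _ ht)
    have h1 := h.norm_neg_norm_le (hup hzΓ)
    rw [hzn] at h1
    have h2 : Real.log ‖f z‖ < Real.log ‖f ((Real.exp ((t₁ + t₂) / 2) : ℝ) : ℂ)‖ := by
      linarith [hlogle z hzΓ, hMexp _ ht]
    exact h1.trans_lt ((Real.log_lt_log_iff (by linarith [hlow z hzΓ])
      (norm_pos_iff.2 (h.ne_zero_of_pos (Real.exp_pos _)))).1 h2))
  set v : ℂ := (((g z₀).im + (g z₀').im) / 2 : ℝ) * I with hv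
  have hvre : v.re = 0 := by simp [hv]
  have hvim : v.im = ((g z₀).im + (g z₀').im) / 2 := by simp [hv]
  have key := length_mul_log_le (F := fun ξ => g (exp ξ) - v) (t₁ := t₁) (t₂ := t₂) (σ := σ)
    (U := T + D) hσ0 hσU ((differentiableOn_log_comp_exp h hd hg t₁ t₂).sub_const v)
    (fun x hx y hy hxy => hinj hx hy (sub_left_injective hxy)) ?_
  · rw [hlen] at key
    exact absurd hnum (not_lt.2 key)
  intro t ht
  obtain ⟨z, hzΓ, hzn⟩ := hcircle _ (hradius t ht)
  have hzim : 0 ≤ z.im := hup hzΓ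
  have hzexp : exp (t + arg z * I) = z := by
    rw [exp_add, ← ofReal_exp, ← hzn, norm_mul_exp_arg_mul_I]
  have harg : arg z ∈ Icc 0 Real.pi := ⟨arg_nonneg_iff.2 hzim, arg_le_pi z⟩
  have hbig : ∀ θ ∈ Icc 0 (arg z), 1 < ‖f (exp (t + θ * I))‖ := by
    intro θ hθ
    have := h.antitoneOn_norm_exp t ⟨hθ.1, hθ.2.trans harg.2⟩ harg hθ.2
    simp only [hzexp] at this
    exact (hlow z hzΓ).trans_le this
  have hmem : ∀ θ ∈ Icc 0 (arg z), exp (t + θ * I) ∈ logDomain f := by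
    intro θ hθ
    refine mem_logDomain (exp_im_nonneg ⟨hθ.1, hθ.2.trans harg.2⟩) fun h0 => ?_
    have := hbig θ hθ
    rw [h0, norm_zero] at this
    linarith
  refine ⟨arg z, harg, ?_, ?_, ?_, ?_⟩
  · refine ContinuousOn.sub ?_ continuousOn_const
    exact hg.differentiableOn.continuousOn.comp (by fun_prop) hmem
  · intro θ hθ
    rw [sub_re, hvre, sub_zero, hg.re_eq (hmem θ hθ)]
    exact Real.log_pos (hbig θ hθ)
  · have h0 := hmem 0 ⟨le_rfl, harg.1⟩
    rw [ofReal_zero, zero_mul, add_zero] at h0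
    refine le_trans ?_ ((le_abs_self _).trans (abs_re_le_norm _))
    rw [sub_re, hvre, sub_zero, hg.re_eq h0, ← ofReal_exp]
    exact hMexp t ht
  · rw [hzexp]
    have hzG : z ∈ logDomain f := hzexp ▸ hmem _ ⟨harg.1, le_rfl⟩
    obtain ⟨h1, h2⟩ := hz z hzΓ
    have h3 : 0 < Real.log ‖f z‖ := Real.log_pos (hlow z hzΓ)
    have h4 := hlogle z hzΓ
    rw [hσ]
    refine Real.le_sqrt_of_sq_le ?_
    rw [← normSq_eq_norm_sq, normSq_apply, sub_re, sub_im, hvre, hvim, sub_zero, hg.re_eq hzG]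
    have h5 : Real.log ‖f z‖ * Real.log ‖f z‖ ≤ T ^ 2 := by
      rw [pow_two]
      exact mul_self_le_mul_self h3.le h4
    have h6 : ((g z).im - ((g z₀).im + (g z₀').im) / 2) ^ 2 ≤ (e * Q) ^ 2 :=
      sq_le_sq' (by linarith) (by linarith)
    linarith

end

/-! ### Hadamard convexity and the final constants -/

/-- The defining property of a Hadamard constant in logarithmic form: `log M(r) / log r` increases. -/
lemma HasSymmetricProduct.log_maxMod_mul_log_div_le {f : ℂ → ℂ} {c : ℝ} {p₀ : ℕ} {p : ℕ → ℕ}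
    {a : ℕ → ℝ} (h : HasSymmetricProduct f c p₀ p a) {R₁ : ℝ} (hR₁ : IsHadamardConstant f R₁)
    {r x : ℝ} (hr : R₁ ≤ r) (hr1 : 1 < r) (hrx : r ≤ x) :
    Real.log (maxMod f r) * Real.log x / Real.log r ≤ Real.log (maxMod f x) := by
  have hlog : 0 < Real.log r := Real.log_pos hr1
  have hr0 : 0 < r := by linarith
  rcases hrx.eq_or_lt with rfl | hlt
  · rw [mul_div_assoc, div_self hlog.ne', mul_one]
  have hκ : 1 < Real.log x / Real.log r := (one_lt_div hlog).2 (Real.log_lt_log hr0 hlt)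
  have hpow : r ^ (Real.log x / Real.log r) = x := by
    rw [Real.rpow_def_of_pos hr0, mul_div_cancel₀ _ hlog.ne', Real.exp_log (hr0.trans hlt)]
  have h1 := hR₁.2 r hr _ hκ
  rw [hpow] at h1
  have h2 := Real.log_le_log (Real.rpow_pos_of_pos (h.maxMod_pos hr0) _) h1
  rw [Real.log_rpow (h.maxMod_pos hr0)] at h2
  calc _ = Real.log x / Real.log r * Real.log (maxMod f r) := by ring
    _ ≤ _ := h2

lemma exists_norm_eq_of_isPreconnected {F : ℂ → ℂ} (hF : Continuous F) {γ : Set ℂ}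
    (hγ : IsPreconnected γ) {z w : ℂ} (hz : z ∈ γ) (hw : w ∈ γ) {r : ℝ} (h₁ : ‖F z‖ ≤ r)
    (h₂ : r ≤ ‖F w‖) : ∃ ζ ∈ γ, ‖F ζ‖ = r :=
  hγ.intermediate_value hz hw hF.norm.continuousOn ⟨h₁, h₂⟩

lemma mul_div_mul_mono {X u v u' v' : ℝ} (hX : 0 ≤ X) (h : u / v ≤ u' / v') :
    Real.pi ^ 2 * X * u / (48 * √2 * v) ≤ Real.pi ^ 2 * X * u' / (48 * √2 * v') := by
  rw [mul_div_mul_comm _ u, mul_div_mul_comm _ u']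
  gcongr

lemma two_pi_le_mul_div_mul {X u v : ℝ} (hX : 48 * √2 / Real.pi ≤ X) (h : 2 ≤ u / v) :
    2 * Real.pi ≤ Real.pi ^ 2 * X * u / (48 * √2 * v) := by
  have hpi := Real.pi_pos
  rw [div_le_iff₀ hpi] at hX
  have h2 : Real.pi ≤ Real.pi ^ 2 * X / (48 * √2) := by
    rw [le_div_iff₀ (by positivity)]
    nlinarith
  rw [mul_div_mul_comm _ u, mul_comm 2 Real.pi]
  exact mul_le_mul h2 h zero_le_two (hpi.le.trans h2)

end EntireWinding

theorem theorem2p2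
    (f : ℂ → ℂ) (c : ℝ) (p₀ : ℕ) (p : ℕ → ℕ) (a : ℕ → ℝ)
    (hf : EntireWinding.IsTranscendentalEntire f)
    (hprod : EntireWinding.HasSymmetricProduct f c p₀ p a)
    (m R₀ : ℝ) (hm : 1 < m) (hR₀ : 0 < R₀)
    (hmin : ∀ r : ℝ, R₀ ≤ r →
      ∃ ρ ∈ Set.Ioo r (r ^ m), EntireWinding.maxMod f r ≤ EntireWinding.minMod f ρ)
    (R₁ : ℝ) (hR₁ : EntireWinding.IsHadamardConstant f R₁)
    (s l b : ℝ) (hs : 0 < s) (hl : 0 < l) (hb : 0 < b)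
    (hs_ge : max 1 (max R₀ R₁) ≤ s)
    (hl_ge : max m (1 + b) ≤ l)
    (hMs : s ^ 2 ≤ EntireWinding.maxMod f s)
    (hsb : 48 * √2 / Real.pi ≤ s ^ (b / 4))
    (hsbl : 384 * √2 / Real.pi ≤ b * s ^ (b / 4) / (l - b))
    (γ : Set ℂ) (hγ : EntireWinding.IsContinuum γ)
    (hγ_upper : γ ⊆ {z : ℂ | 0 ≤ z.im})
    (hγ_s : EntireWinding.Meets γ (EntireWinding.circle s))
    (hγ_sl : EntireWinding.Meets γ (EntireWinding.circle (s ^ l))) :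
    (EntireWinding.Meets (f '' γ) (EntireWinding.circle (EntireWinding.maxMod f s)) ∧
      EntireWinding.Meets (f '' γ)
        (EntireWinding.circle (EntireWinding.maxMod f s ^ (l - b)))) ∨
    (EntireWinding.Meets (f '' γ)
        (EntireWinding.circle (EntireWinding.maxMod f s ^ (1 / l))) ∧
      EntireWinding.Meets (f '' γ) (EntireWinding.circle (EntireWinding.maxMod f s))) ∨
    (∃ (Γ : Set ℂ) (z₀ z₀' : ℂ) (δ : ℝ),
      EntireWinding.IsContinuum Γ ∧
      Γ ⊆ γ ∩ EntireWinding.closedAnnulus (s ^ (l - b)) (s ^ l) ∧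
      f '' Γ ⊆ EntireWinding.closedAnnulus
        (EntireWinding.maxMod f s ^ (1 / l)) (EntireWinding.maxMod f s ^ (l - b)) ∧
      EntireWinding.IsArgChange f Γ z₀ z₀' δ ∧
      Real.pi ^ 2 * s ^ (b / 4) * Real.log (EntireWinding.maxMod f (s ^ (l - b))) /
        (48 * √2 * Real.log (s ^ (l - b))) ≤ δ ∧
      Real.pi ^ 2 * s ^ (b / 4) * Real.log (EntireWinding.maxMod f s) /
        (48 * √2 * Real.log s) ≤
      Real.pi ^ 2 * s ^ (b / 4) * Real.log (EntireWinding.maxMod f (s ^ (l - b))) /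
        (48 * √2 * Real.log (s ^ (l - b))) ∧
      2 * Real.pi ≤
      Real.pi ^ 2 * s ^ (b / 4) * Real.log (EntireWinding.maxMod f s) /
        (48 * √2 * Real.log s)) := by
  have hpi := Real.pi_pos
  obtain ⟨hs1, hs2⟩ := max_le_iff.1 hs_ge
  obtain ⟨hsR₀, hsR₁⟩ := max_le_iff.1 hs2
  obtain ⟨hml, hbl⟩ := max_le_iff.1 hl_ge
  have hlb : 1 ≤ l - b := by linarith
  have hX21 := EntireWinding.lt_fortyeight_mul_sqrt_two_div_pi.trans_le hsb
  have hs1' : 1 < s := by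
    refine lt_of_le_of_ne hs1 fun h1 => ?_
    rw [← h1, Real.one_rpow] at hX21
    norm_num at hX21
  have hlogs : 0 < Real.log s := Real.log_pos hs1'
  set M := EntireWinding.maxMod f s with hM
  have hM1 : 1 < M := (one_lt_pow₀ hs1' two_ne_zero).trans_le hMs
  have hlogM : 2 * Real.log s ≤ Real.log M := by
    have := Real.log_le_log (by positivity) hMs
    rwa [Real.log_pow] at this
  have hreal : ∀ z, f z = 0 → z.im = 0 := fun z hz => (hprod.eq_zero_imp hf.1 hz).1
  have hcont : Continuous f := hf.1.continuous
  obtain ⟨zs, hzsγ, hzs⟩ := hγ_s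
  obtain ⟨zl, hzlγ, hzl⟩ := hγ_sl
  have hzs : ‖zs‖ = s := hzs
  have hzl : ‖zl‖ = s ^ l := hzl
  have hpre := hγ.2.isPreconnected
  have hcircle : ∀ r ∈ Set.Icc s (s ^ l), ∃ z ∈ γ, ‖z‖ = r := fun r hr =>
    EntireWinding.exists_norm_eq_of_isPreconnected continuous_id hpre hzsγ hzlγ
      (hzs.le.trans hr.1) (hr.2.trans hzl.ge)
  -- The image of `γ` meets the circle of radius `M(s)` because of the minimum modulus condition.
  obtain ⟨zM, hzMγ, hzM⟩ : ∃ z ∈ γ, ‖f z‖ = M := by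
    obtain ⟨ρ, hρ, hmod⟩ := hmin s hsR₀
    obtain ⟨zρ, hzργ, hzρ⟩ := hcircle ρ
      ⟨hρ.1.le, hρ.2.le.trans (Real.rpow_le_rpow_of_exponent_le hs1 hml)⟩
    refine EntireWinding.exists_norm_eq_of_isPreconnected hcont hpre hzsγ hzργ
      (hprod.norm_le_maxMod hzs.le) (hmod.trans ?_)
    rw [← hzρ]
    exact EntireWinding.minMod_le_norm f zρ
  have hmeetsM : EntireWinding.Meets (f '' γ) (EntireWinding.circle M) :=
    ⟨f zM, ⟨zM, hzMγ, rfl⟩, hzM⟩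
  by_cases hA : EntireWinding.Meets (f '' γ) (EntireWinding.circle (M ^ (l - b)))
  · exact Or.inl ⟨hmeetsM, hA⟩
  by_cases hB : EntireWinding.Meets (f '' γ) (EntireWinding.circle (M ^ (1 / l)))
  · exact Or.inr (Or.inl ⟨hB, hmeetsM⟩)
  refine Or.inr (Or.inr ?_)
  have hMA : M ≤ M ^ (l - b) := Real.self_le_rpow_of_one_le hM1.le hlb
  have hMB : M ^ (1 / l) ≤ M := Real.rpow_le_self_of_one_le hM1.le
    ((div_le_one hl).2 (by linarith))
  have hhigh : ∀ z ∈ γ, ‖f z‖ < M ^ (l - b) := by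
    intro z hz
    by_contra! hcon
    obtain ⟨w, hw, hwn⟩ := EntireWinding.exists_norm_eq_of_isPreconnected hcont hpre hzMγ hz
      (hzM.le.trans hMA) hcon
    exact hA ⟨f w, ⟨w, hw, rfl⟩, hwn⟩
  have hlow : ∀ z ∈ γ, M ^ (1 / l) < ‖f z‖ := by
    intro z hz
    by_contra! hcon
    obtain ⟨w, hw, hwn⟩ := EntireWinding.exists_norm_eq_of_isPreconnected hcont hpre hz hzMγ
      hcon (hMB.trans hzM.ge)
    exact hB ⟨f w, ⟨w, hw, rfl⟩, hwn⟩
  have hone : ∀ z ∈ γ, 1 < ‖f z‖ := fun z hz =>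
    (Real.one_lt_rpow hM1 (by positivity)).trans (hlow z hz)
  have hne : ∀ z ∈ γ, f z ≠ 0 := fun z hz h0 => by
    have := hone z hz
    rw [h0, norm_zero] at this
    linarith
  set R := s ^ (l - b) with hR
  set X := s ^ (b / 4) with hX
  set T := Real.log (EntireWinding.maxMod f R) with hT
  have hX0 : 0 < X := by linarith
  have hsR : s ≤ R := Real.self_le_rpow_of_one_le hs1 hlb
  have hR1 : 1 < R := hs1'.trans_le hsR
  have hR0 : 0 < R := by linarith
  have hlogR : Real.log R = (l - b) * Real.log s := Real.log_rpow hs _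
  have hlogX : Real.log X = b / 4 * Real.log s := Real.log_rpow hs _
  have hRX4 : R * X ^ 4 = s ^ l := by
    rw [hR, hX, ← Real.rpow_natCast, ← Real.rpow_mul hs.le, ← Real.rpow_add hs]
    congr 1
    push_cast
    ring
  have hR2 : R ≤ R * X ^ 2 := le_mul_of_one_le_right hR0.le (one_le_pow₀ (by linarith))
  have h24 : R * X ^ 2 < R * X ^ 4 := by
    gcongr
    · linarith
    · norm_num
  have hlogR0 : 0 < Real.log R := Real.log_pos hR1
  have hTs : Real.log M / Real.log s ≤ T / Real.log R := by
    have := hprod.log_maxMod_mul_log_div_le hR₁ hsR₁ hs1' hsR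
    rwa [le_div_iff₀ hlogR0, div_mul_eq_mul_div]
  have hT0 : 0 < T := by
    have h1 : 0 < T / Real.log R := lt_of_lt_of_le (div_pos (by linarith) hlogs) hTs
    exact (div_pos_iff_of_pos_right hlogR0).1 h1
  have hMR : M ^ (l - b) ≤ EntireWinding.maxMod f R := by
    rcases hlb.eq_or_lt with h1 | h1
    · rw [hR, ← h1, Real.rpow_one, Real.rpow_one]
    · exact hR₁.2 s hsR₁ _ h1
  have hslit : ∀ x ∈ Set.Icc 0 (R * X ^ 2),
      ‖f ((-x : ℝ) : ℂ)‖ ≤ EntireWinding.maxMod f R := by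
    intro x hx
    rcases le_total x R with hxR | hxR
    · refine hprod.norm_le_maxMod ?_
      rwa [Complex.norm_real, norm_neg, Real.norm_of_nonneg hx.1]
    · obtain ⟨z, hz, hzn⟩ := hcircle x ⟨hsR.trans hxR, hRX4 ▸ hx.2.trans h24.le⟩
      have := hprod.norm_neg_norm_le (hγ_upper hz)
      rw [hzn] at this
      exact this.trans ((hhigh z hz).le.trans hMR)
  have hRX : 384 * √2 / Real.pi * Real.log R ≤ 4 * X * Real.log X := by
    have h1 : 0 < l - b := by linarith
    calc 384 * √2 / Real.pi * Real.log R
        ≤ b * X / (l - b) * Real.log R := by gcongr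
      _ = 4 * X * Real.log X := by
        rw [hlogR, hlogX]
        field_simp
  obtain ⟨Γ, hΓsub, hΓ, ⟨z₁, hz₁Γ, hz₁⟩, z₂, hz₂Γ, hz₂⟩ :=
    EntireWinding.exists_continuum_crossing hγ h24
      ⟨zs, hzsγ, hzs.le.trans (hsR.trans hR2)⟩ ⟨zl, hzlγ, (hRX4.trans hzl.symm).le⟩
  have hΓγ : Γ ⊆ γ := fun z hz => (hΓsub hz).1
  have hΓup : Γ ⊆ {z : ℂ | 0 ≤ z.im} := hΓγ.trans hγ_upper
  obtain ⟨g, hg⟩ := EntireWinding.exists_isLogBranchAround hf.1 hreal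
  have hgc : ContinuousOn (fun z => (g z).im) Γ :=
    Complex.continuous_im.comp_continuousOn (hg.differentiableOn.continuousOn.mono
      fun z hz => EntireWinding.mem_logDomain (hΓup hz) (hne z (hΓγ hz)))
  obtain ⟨z₀, hz₀, hmin₀⟩ := hΓ.1.exists_isMinOn hΓ.2.nonempty hgc
  obtain ⟨z₀', hz₀', hmax₀⟩ := hΓ.1.exists_isMaxOn hΓ.2.nonempty hgc
  have hwind := EntireWinding.le_im_sub_im hprod hf.1 hg hR1 hT hT0 hsb hRX
    (fun x hx => hprod.log_maxMod_mul_log_div_le hR₁ (hsR₁.trans hsR) hR1 hx) hslit hΓup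
    (fun z hz => hone z (hΓγ hz)) (fun z hz => (hhigh z (hΓγ hz)).le.trans hMR)
    (fun r hr => EntireWinding.exists_norm_eq_of_isPreconnected continuous_id
      hΓ.2.isPreconnected hz₁Γ hz₂Γ (hz₁.le.trans hr.1.le) (hr.2.le.trans hz₂.ge))
    (fun z hz => ⟨hmin₀ hz, hmax₀ hz⟩)
  have hpos : 0 < Real.pi ^ 2 * X * T / (48 * √2 * Real.log R) := by positivity
  have hz_ne : z₀ ≠ z₀' := by
    rintro rfl
    linarith
  refine ⟨Γ, z₀, z₀', (g z₀').im - (g z₀).im, hΓ, ?_, ?_,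
    EntireWinding.isArgChange_of_branch hreal hg hΓ.2.isPreconnected hΓup
      (fun z hz => hne z (hΓγ hz)) hz₀ hz₀' hz_ne, hwind, ?_, ?_⟩
  · exact fun z hz => ⟨hΓγ hz, hR2.trans (hΓsub hz).2.1, (hΓsub hz).2.2.trans hRX4.le⟩
  · rintro _ ⟨z, hz, rfl⟩
    exact ⟨(hlow z (hΓγ hz)).le, (hhigh z (hΓγ hz)).le⟩
  · exact EntireWinding.mul_div_mul_mono hX0.le hTs
  · exact EntireWinding.two_pi_le_mul_div_mul hsb ((le_div_iff₀ hlogs).2 hlogM)
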